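/- Let $M$ be a (finite-dimensional, Hausdorff) real-analytic manifold, $x_0\in M$, and $G$ a compact, connected, non-Abelian Lie group with Lie algebra $\mathfrak g$. A loop is a continuous, piecewise real-analytic map $\alpha:[0,1]\to M$ with $\alpha(0)=\alpha(1)=x_0$ (analytic on each closed interval of some finite partition of $[0,1]$). For a smooth $\mathfrak g$-valued 1-form $A$ on $M$, the holonomy $\mathcal P\exp\int_\alpha A\in G$ is $g(1)$, where $g:[0,1]\to G$ is the continuous solution of $g'(t)\,g(t)^{-1}=A(\alpha'(t))$ (for all but finitely many $t$) with $g(0)=1$. Two loops are holonomy equivalent if their holonomies agree for every such $A$; the equivalence classes are called hoops. Composition of loops ($\alpha\circ\beta$: first $\beta$, then $\alpha$) and reversal of loops make the set of hoops a group, the hoop group $\mathcal{HG}$. Loops $\alpha_1,\dots,\alpha_n$ are independent if each $\alpha_i$ contains an open segment $\alpha_i((a,b))$, $0\le a<b\le 1$, which it traverses only once and which meets each $\alpha_j$ with $j\ne i$ in at most finitely many points. Hoops are independent if they have independent representatives. A subgroup $S\subseteq\mathcal{HG}$ is tame if it is generated by finitely many (possibly zero) independent hoops. Let $L$ be the set of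 tame subgroups, ordered by inclusion. For $S\in L$ let $\mathcal X_S=\mathrm{Hom}(S,G)$ (group homomorphisms), for $S\subseteq S'$ in $L$ let $p_{SS'}:\mathcal X_{S'}\to\mathcal X_S$ be the restriction map, and let $$\overline{\mathcal X}=\Big\{(x_S)_{S\in L}\in\prod_{S\in L}\mathcal X_S\ :\ p_{SS'}(x_{S'})=x_S\ \text{ whenever } S\subseteq S'\Big\}$$ be the projective limit. Proposition. The map $\mathrm{Hom}(\mathcal{HG},G)\to\overline{\mathcal X}$, $H\mapsto (H|_S)_{S\in L}$, is a bijection. -/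

import Mathlib

open Set Filter Topology
open scoped Manifold ContDiff

set_option linter.unusedSectionVars false

namespace Hoop

noncomputable section

section LieTransport

variable {V : Type*} [NormedAddCommGroup V] [NormedSpace ℝ V]
  {G : Type*} [TopologicalSpace G] [ChartedSpace V G] [Group G]

/-- `g'(t) g(t)⁻¹ = ξ` : the derivative at `s = t` of the curve `s ↦ g(s) g(t)⁻¹`, which passes
through `1` at `s = t`, is the element `ξ` of the Lie algebra. -/
def HasRightLogDerivAt (g : ℝ → G) (ξ : GroupLieAlgebra 𝓘(ℝ, V) G) (t : ℝ) : Prop :=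
  HasMFDerivAt 𝓘(ℝ, ℝ) 𝓘(ℝ, V) (fun s => g s * (g t)⁻¹) t
    (ContinuousLinearMap.toSpanSingleton ℝ (ξ : V))

/-- `g` is continuous on `[a, b]` and solves `g' = X g` there, except at finitely many times. The
Lie algebra of `G`, the tangent space at `1`, is a copy of the model space `V`. -/
def SolvesOn (X : ℝ → V) (a b : ℝ) (g : ℝ → G) : Prop :=
  ContinuousOn g (Icc a b) ∧
    ∃ F : Finset ℝ, ∀ t ∈ Ioo a b, t ∉ F → HasRightLogDerivAt g (X t) t

variable [LieGroup 𝓘(ℝ, V) ∞ G]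

theorem hasRightLogDerivAt_iff (g : ℝ → G) (ξ : V) (t : ℝ) :
    HasRightLogDerivAt g ξ t ↔ ContinuousAt g t ∧
      HasDerivAt (fun s => extChartAt 𝓘(ℝ, V) (1 : G) (g s * (g t)⁻¹)) ξ t := by
  have := topologicalGroup_of_lieGroup 𝓘(ℝ, V) ∞ (G := G)
  unfold HasRightLogDerivAt HasMFDerivAt
  refine and_congr ⟨fun h => ?_, fun h => h.mul continuousAt_const⟩ ?_
  · exact (h.mul (continuousAt_const (y := g t))).congr (.of_forall fun s => by simp)
  · simp only [writtenInExtChartAt, mul_inv_cancel]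
    change HasFDerivWithinAt (fun s : ℝ => extChartAt 𝓘(ℝ, V) (1 : G) (g s * (g t)⁻¹))
      (ContinuousLinearMap.toSpanSingleton ℝ ξ) (range (id : ℝ → ℝ)) t ↔ _
    rw [range_id, hasFDerivWithinAt_univ, hasDerivAt_iff_hasFDerivAt]

theorem HasRightLogDerivAt.congr {g g' : ℝ → G} {ξ : V} {t : ℝ}
    (h : HasRightLogDerivAt g ξ t) (hg : g' =ᶠ[𝓝 t] g) : HasRightLogDerivAt g' ξ t := by
  rw [hasRightLogDerivAt_iff] at h ⊢
  refine ⟨h.1.congr hg.symm, h.2.congr_of_eventuallyEq ?_⟩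
  filter_upwards [hg] with s hs
  rw [hs, hg.eq_of_nhds]

theorem HasRightLogDerivAt.mul_right {g : ℝ → G} {ξ : V} {t : ℝ}
    (h : HasRightLogDerivAt g ξ t) (c : G) : HasRightLogDerivAt (fun s => g s * c) ξ t := by
  rw [hasRightLogDerivAt_iff] at h ⊢
  have := topologicalGroup_of_lieGroup 𝓘(ℝ, V) ∞ (G := G)
  exact ⟨h.1.mul continuousAt_const, by simpa [mul_assoc] using h.2⟩

theorem HasRightLogDerivAt.comp_affine {g : ℝ → G} {ξ : V} {t p q : ℝ}
    (h : HasRightLogDerivAt g ξ (p * t + q)) :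
    HasRightLogDerivAt (fun s => g (p * s + q)) ((p • ξ : V)) t := by
  rw [hasRightLogDerivAt_iff] at h ⊢
  have hd : HasDerivAt (fun s : ℝ => p * s + q) p t := by
    simpa using ((hasDerivAt_id t).const_mul p).add_const q
  refine ⟨ContinuousAt.comp (f := fun s : ℝ => p * s + q) h.1 (by fun_prop), ?_⟩
  exact HasDerivAt.scomp (h := fun s : ℝ => p * s + q) t h.2 hd

/-- A smooth map into `G`, read in a chart of `G`, is smooth. -/
theorem contDiffAt_chart {W : Type*} [NormedAddCommGroup W] [NormedSpace ℝ W] {f : W → G} {w : W}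
    (hf : ContMDiffAt 𝓘(ℝ, W) 𝓘(ℝ, V) ∞ f w) (c : G)
    (hc : f w ∈ (extChartAt 𝓘(ℝ, V) c).source) :
    ContDiffAt ℝ ∞ (fun x => extChartAt 𝓘(ℝ, V) c (f x)) w := by
  have : IsManifold 𝓘(ℝ, V) ∞ G := inferInstance
  rw [← contMDiffAt_iff_contDiffAt]
  exact (contMDiffAt_extChartAt' (by simpa using hc)).comp w hf

theorem contMDiffAt_chart_symm :
    ContMDiffAt 𝓘(ℝ, V) 𝓘(ℝ, V) ∞ (extChartAt 𝓘(ℝ, V) (1 : G)).symm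
      (extChartAt 𝓘(ℝ, V) (1 : G) 1) :=
  (contMDiffOn_extChartAt_symm (1 : G)).contMDiffAt (extChartAt_target_mem_nhds (1 : G))

theorem eq_of_zero_deriv [CompleteSpace V] [T2Space G] {a b : ℝ} {k : ℝ → G} (hk : ContinuousOn k (Icc a b))
    (F : Finset ℝ) (hd : ∀ t ∈ Ioo a b, t ∉ F → ∀ c : G, k t ∈ (extChartAt 𝓘(ℝ, V) c).source →
      HasDerivAt (fun s => extChartAt 𝓘(ℝ, V) c (k s)) (0 : V) t) :
    ∀ t ∈ Icc a b, k t = k a := by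
  rcases lt_or_ge b a with hab | hab
  · simp [Icc_eq_empty_of_lt hab]
  have hcl : IsClosed ({t | k t = k a} ∩ Icc a b) := by
    have := hk.preimage_isClosed_of_isClosed isClosed_Icc (isClosed_singleton (x := k a))
    rwa [inter_comm] at this
  refine hcl.Icc_subset_of_forall_mem_nhdsWithin rfl ?_
  rintro x ⟨hx, hxa, hxb⟩
  change k x = k a at hx
  let ψ := extChartAt 𝓘(ℝ, V) (k x)
  have hcont := hk x ⟨hxa, hxb.le⟩
  have hsrc : ∀ᶠ s in 𝓝[Icc a b] x, k s ∈ ψ.source :=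
    hcont (extChartAt_source_mem_nhds (k x))
  have h1 : ∀ᶠ s in 𝓝[≥] x, k s ∈ ψ.source :=
    hsrc.filter_mono (by
      rw [← nhdsWithin_Icc_eq_nhdsGE hxb]
      exact nhdsWithin_mono _ (Icc_subset_Icc_left hxa))
  obtain ⟨u, hu, hus⟩ := mem_nhdsGE_iff_exists_Icc_subset.1 h1
  have hu' : x < u := hu
  have : Ioo x (min u b) ∈ 𝓝[>] x := Ioo_mem_nhdsGT (lt_min hu' hxb)
  filter_upwards [this] with y hy
  have hyu : y < u := hy.2.trans_le (min_le_left _ _)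
  have hyb : y < b := hy.2.trans_le (min_le_right _ _)
  have hsub : ∀ s ∈ Icc x y, k s ∈ ψ.source := fun s hs => hus ⟨hs.1, hs.2.trans hyu.le⟩
  have hkc : ContinuousOn k (Icc x y) := hk.mono (Icc_subset_Icc hxa hyb.le)
  have hc : ContinuousOn (fun s => ψ (k s)) (Icc x y) :=
    (continuousOn_extChartAt (k x)).comp hkc hsub
  have := MeasureTheory.integral_eq_of_hasDerivAt_off_countable_of_le (fun s => ψ (k s))
    (fun _ => (0 : V)) hy.1.le F.countable_toSet hc
    (fun s hs => hd s ⟨hxa.trans_lt hs.1.1, hs.1.2.trans hyb⟩ (by simpa using hs.2) (k x)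
      (hsub s (Ioo_subset_Icc_self hs.1))) (by simp)
  have h2 : ψ (k y) = ψ (k x) := by
    rw [intervalIntegral.integral_zero] at this
    exact (sub_eq_zero.1 this.symm)
  have := ψ.injOn (hsub y ⟨hy.1.le, le_rfl⟩) (hsub x ⟨le_rfl, hy.1.le⟩) h2
  change k y = k a
  rw [this, hx]

theorem SolvesOn.unique [CompleteSpace V] [T2Space G] {X : ℝ → V} {a b : ℝ} {g h : ℝ → G}
    (hg : SolvesOn X a b g) (hh : SolvesOn X a b h) (hab : g a = h a) :
    ∀ t ∈ Icc a b, g t = h t := by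
  have := topologicalGroup_of_lieGroup 𝓘(ℝ, V) ∞ (G := G)
  obtain ⟨hgc, F, hF⟩ := hg
  obtain ⟨hhc, F', hF'⟩ := hh
  let φ := extChartAt 𝓘(ℝ, V) (1 : G)
  have hsrc1 : (1 : G) ∈ φ.source := mem_extChartAt_source _
  have hsymm : φ.symm (φ 1) = 1 := φ.left_inv hsrc1
  have key := eq_of_zero_deriv (V := V) (hgc.inv.mul hhc) (F ∪ F') (by
    intro t ht htF c hc
    simp only [Finset.mem_union, not_or] at htF
    obtain ⟨gc, gd⟩ := (hasRightLogDerivAt_iff _ _ _).1 (hF t ht htF.1)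
    obtain ⟨hc', hd'⟩ := (hasRightLogDerivAt_iff _ _ _).1 (hF' t ht htF.2)
    let N : V × V → G := fun p => (g t)⁻¹ * ((φ.symm p.1)⁻¹ * φ.symm p.2) * h t
    have hs1 : ContMDiffAt 𝓘(ℝ, V × V) 𝓘(ℝ, V) ∞ (fun p : V × V => φ.symm p.1) (φ 1, φ 1) := by
      refine ContMDiffAt.comp (I' := 𝓘(ℝ, V)) _ (f := Prod.fst) contMDiffAt_chart_symm ?_
      exact contDiffAt_fst.contMDiffAt
    have hs2 : ContMDiffAt 𝓘(ℝ, V × V) 𝓘(ℝ, V) ∞ (fun p : V × V => φ.symm p.2) (φ 1, φ 1) := by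
      refine ContMDiffAt.comp (I' := 𝓘(ℝ, V)) _ (f := Prod.snd) contMDiffAt_chart_symm ?_
      exact contDiffAt_snd.contMDiffAt
    have hN : ContMDiffAt 𝓘(ℝ, V × V) 𝓘(ℝ, V) ∞ N (φ 1, φ 1) :=
      (contMDiffAt_const.mul (hs1.inv.mul hs2)).mul contMDiffAt_const
    have hN1 : N (φ 1, φ 1) = (g t)⁻¹ * h t := by simp [N, hsymm]
    have hN' := (contDiffAt_chart hN c (by rw [hN1]; exact hc)).differentiableAt (by simp)
    have hpair : HasDerivAt (fun s => (φ (g s * (g t)⁻¹), φ (h s * (h t)⁻¹))) ((X t, X t) : V × V) t :=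
      gd.prodMk hd'
    have e1 : (φ (g t * (g t)⁻¹), φ (h t * (h t)⁻¹)) = (φ 1, φ 1) := by simp
    have hcomp : HasDerivAt (fun s => extChartAt 𝓘(ℝ, V) c (N (φ (g s * (g t)⁻¹), φ (h s * (h t)⁻¹))))
        (fderiv ℝ (fun p => extChartAt 𝓘(ℝ, V) c (N p)) (φ 1, φ 1) (X t, X t)) t := by
      refine HasFDerivAt.comp_hasDerivAt (l := fun p => extChartAt 𝓘(ℝ, V) c (N p)) t ?_ hpair
      rw [e1]
      exact hN'.hasFDerivAt
    have hdiag : fderiv ℝ (fun p => extChartAt 𝓘(ℝ, V) c (N p)) (φ 1, φ 1) (X t, X t) = 0 := by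
      have hl : HasDerivAt (fun r : ℝ => ((φ 1 + r • X t, φ 1 + r • X t) : V × V))
          (X t, X t) 0 := by
        have : HasDerivAt (fun r : ℝ => φ 1 + r • X t) (X t) 0 := by
          simpa using ((hasDerivAt_id (0 : ℝ)).smul_const (X t)).const_add (φ 1)
        exact this.prodMk this
      have h3 : HasDerivAt (fun r : ℝ => extChartAt 𝓘(ℝ, V) c (N (φ 1 + r • X t, φ 1 + r • X t)))
          (fderiv ℝ (fun p => extChartAt 𝓘(ℝ, V) c (N p)) (φ 1, φ 1) (X t, X t)) 0 := by
        refine HasFDerivAt.comp_hasDerivAt (l := fun p => extChartAt 𝓘(ℝ, V) c (N p)) 0 ?_ hl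
        simpa using hN'.hasFDerivAt
      refine h3.unique ?_
      simp only [N, inv_mul_cancel]
      exact hasDerivAt_const _ _
    rw [hdiag] at hcomp
    refine hcomp.congr_of_eventuallyEq ?_
    have n1 : ∀ᶠ s in 𝓝 t, g s * (g t)⁻¹ ∈ φ.source := by
      have : ContinuousAt (fun s => g s * (g t)⁻¹) t := gc.mul continuousAt_const
      exact this (by
        simp only [mul_inv_cancel]; exact extChartAt_source_mem_nhds (I := 𝓘(ℝ, V)) (1 : G))
    have n2 : ∀ᶠ s in 𝓝 t, h s * (h t)⁻¹ ∈ φ.source := by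
      have : ContinuousAt (fun s => h s * (h t)⁻¹) t := hc'.mul continuousAt_const
      exact this (by
        simp only [mul_inv_cancel]; exact extChartAt_source_mem_nhds (I := 𝓘(ℝ, V)) (1 : G))
    filter_upwards [n1, n2] with s s1 s2
    simp only [N, φ.left_inv s1, φ.left_inv s2]
    congr 1
    simp [mul_assoc])
  intro t ht
  have := key t ht
  simp only [Pi.mul_apply, Pi.inv_apply, hab, inv_mul_cancel] at this
  exact (inv_mul_eq_one.1 this)


theorem SolvesOn.congr {X : ℝ → V} {a b : ℝ} {g : ℝ → G} (hg : SolvesOn X a b g) {Y : ℝ → V}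
    (F : Finset ℝ) (h : ∀ t ∈ Ioo a b, t ∉ F → Y t = X t) : SolvesOn Y a b g := by
  obtain ⟨hc, F', hF'⟩ := hg
  refine ⟨hc, F ∪ F', fun t ht htF => ?_⟩
  simp only [Finset.mem_union, not_or] at htF
  rw [h t ht htF.1]
  exact hF' t ht htF.2

theorem SolvesOn.mono {X : ℝ → V} {a b c d : ℝ} {g : ℝ → G} (hg : SolvesOn X a b g)
    (hac : a ≤ c) (hdb : d ≤ b) : SolvesOn X c d g := by
  obtain ⟨hc, F, hF⟩ := hg
  exact ⟨hc.mono (Icc_subset_Icc hac hdb), F, fun t ht => hF t (Ioo_subset_Ioo hac hdb ht)⟩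

theorem SolvesOn.mul_right {X : ℝ → V} {a b : ℝ} {g : ℝ → G} (hg : SolvesOn X a b g) (c : G) :
    SolvesOn X a b (fun s => g s * c) := by
  have := topologicalGroup_of_lieGroup 𝓘(ℝ, V) ∞ (G := G)
  obtain ⟨hc, F, hF⟩ := hg
  exact ⟨hc.mul continuousOn_const, F, fun t ht htF => (hF t ht htF).mul_right c⟩

theorem SolvesOn.comp_affine {X Y : ℝ → V} {a b c d p q : ℝ} {g : ℝ → G}
    (hg : SolvesOn X c d g) (hp : p ≠ 0) (hI : ∀ t ∈ Icc a b, p * t + q ∈ Icc c d)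
    (hI' : ∀ t ∈ Ioo a b, p * t + q ∈ Ioo c d) (F : Finset ℝ)
    (h : ∀ t ∈ Ioo a b, t ∉ F → Y t = p • X (p * t + q)) :
    SolvesOn Y a b (fun s => g (p * s + q)) := by
  obtain ⟨hc, F', hF'⟩ := hg
  refine ⟨hc.comp (f := fun s : ℝ => p * s + q) (by fun_prop) hI,
    F ∪ F'.image (fun x => (x - q) / p), fun t ht htF => ?_⟩
  simp only [Finset.mem_union, not_or, Finset.mem_image, not_exists, not_and] at htF
  rw [h t ht htF.1]
  refine (hF' _ (hI' t ht) fun hmem => htF.2 _ hmem ?_).comp_affine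
  field_simp
  ring

theorem SolvesOn.glue {X : ℝ → V} {a b c : ℝ} {g h : ℝ → G} (hg : SolvesOn X a b g)
    (hh : SolvesOn X b c h) (hgh : g b = h b) :
    SolvesOn X a c (fun s => if s ≤ b then g s else h s) := by
  obtain ⟨gc, F, hF⟩ := hg
  obtain ⟨hc, F', hF'⟩ := hh
  refine ⟨?_, insert b (F ∪ F'), fun t ht htF => ?_⟩
  · refine ContinuousOn.if' ?_ ?_ ?_ ?_
    · rintro t ⟨ht, hf⟩
      have htb : t = b := by
        have := frontier_le_subset_eq continuous_id continuous_const hf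
        exact this
      subst htb
      simp only [le_refl, if_true]
      have := gc t ⟨ht.1, le_rfl⟩
      exact this.mono (fun s hs => ⟨hs.1.1, hs.2⟩)
    · rintro t ⟨ht, hf⟩
      have htb : t = b := by
        have := frontier_le_subset_eq continuous_id continuous_const hf
        exact this
      subst htb
      simp only [le_refl, if_true]
      rw [hgh]
      have := hc t ⟨le_rfl, ht.2⟩
      exact this.mono (fun s hs => ⟨(not_le.1 hs.2).le, hs.1.2⟩)
    · exact gc.mono (fun s hs => ⟨hs.1.1, hs.2⟩)
    · exact hc.mono (fun s hs => ⟨(not_le.1 hs.2).le, hs.1.2⟩)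
  · simp only [Finset.mem_insert, Finset.mem_union, not_or] at htF
    rcases lt_or_gt_of_ne htF.1 with hlt | hgt
    · refine (hF t ⟨ht.1, hlt⟩ htF.2.1).congr ?_
      filter_upwards [Iio_mem_nhds hlt] with s hs
      exact if_pos (le_of_lt (mem_Iio.1 hs))
    · refine (hF' t ⟨hgt, ht.2⟩ htF.2.2).congr ?_
      filter_upwards [Ioi_mem_nhds hgt] with s hs
      exact if_neg (not_le.2 (mem_Ioi.1 hs))

theorem exists_solvesOn_trans {X : ℝ → V} {a b c : ℝ} (h1 : ∃ g : ℝ → G, SolvesOn X a b g)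
    (h2 : ∃ g : ℝ → G, SolvesOn X b c g) : ∃ g : ℝ → G, SolvesOn X a c g := by
  obtain ⟨g, hg⟩ := h1
  obtain ⟨h, hh⟩ := h2
  exact ⟨_, hg.glue (hh.mul_right ((h b)⁻¹ * g b)) (by simp)⟩

variable (G) in
theorem exists_solvesOn_short [CompleteSpace V] (C : NNReal) : ∃ ε > 0, ∀ X : ℝ → V, Continuous X →
    (∀ t, ‖X t‖ ≤ C) → ∀ a b, a ≤ b → b - a ≤ ε → ∃ g : ℝ → G, SolvesOn X a b g := by
  have := topologicalGroup_of_lieGroup 𝓘(ℝ, V) ∞ (G := G)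
  let φ := extChartAt 𝓘(ℝ, V) (1 : G)
  have hsrc1 : (1 : G) ∈ φ.source := mem_extChartAt_source _
  have hsymm : φ.symm (φ 1) = 1 := φ.left_inv hsrc1
  let e : V := φ 1
  have hs1 : ContMDiffAt 𝓘(ℝ, V × V) 𝓘(ℝ, V) ∞ (fun p : V × V => φ.symm p.1) (e, e) := by
    refine ContMDiffAt.comp (I' := 𝓘(ℝ, V)) _ (f := Prod.fst) contMDiffAt_chart_symm ?_
    exact contDiffAt_fst.contMDiffAt
  have hs2 : ContMDiffAt 𝓘(ℝ, V × V) 𝓘(ℝ, V) ∞ (fun p : V × V => φ.symm p.2) (e, e) := by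
    refine ContMDiffAt.comp (I' := 𝓘(ℝ, V)) _ (f := Prod.snd) contMDiffAt_chart_symm ?_
    exact contDiffAt_snd.contMDiffAt
  let m : V × V → V := fun p => φ (φ.symm p.1 * φ.symm p.2)
  let n : V × V → V := fun p => φ (φ.symm p.1 * (φ.symm p.2)⁻¹)
  have hm : ContDiffAt ℝ ∞ m (e, e) :=
    contDiffAt_chart (hs1.mul hs2) 1 (by simp [hsymm, e])
  have hn : ContDiffAt ℝ ∞ n (e, e) :=
    contDiffAt_chart (hs1.mul hs2.inv) 1 (by simp [hsymm, e])
  let L : V → V →L[ℝ] V := fun w => fderiv ℝ (fun w' => m (w', w)) e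
  have hL : ContDiffAt ℝ 1 L e := by
    refine ContDiffAt.fderiv (n := ∞) (f := fun w w' => m (w', w)) (g := fun _ => e) ?_
      contDiffAt_const (by rw [one_add_one_eq_two]; exact ENat.LEInfty.out)
    exact ContDiffAt.comp (f := fun p : V × V => (p.2, p.1)) (e, e) hm (by fun_prop)
  have A1 : ∀ᶠ w in 𝓝 e, w ∈ φ.target := extChartAt_target_mem_nhds (1 : G)
  have cL : Tendsto (fun w : V => (e, w)) (𝓝 e) (𝓝 (e, e)) := by
    have : Continuous (fun w : V => (e, w)) := by fun_prop
    exact this.tendsto e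
  have cD : Tendsto (fun w : V => (w, w)) (𝓝 e) (𝓝 (e, e)) := by
    have : Continuous (fun w : V => (w, w)) := by fun_prop
    exact this.tendsto e
  have A2 : ∀ᶠ w in 𝓝 e, DifferentiableAt ℝ (fun w' => m (w', w)) e := by
    have := (hm.of_le (m := 1) (by exact_mod_cast le_top)).eventually (by simp)
    filter_upwards [cL.eventually this] with w hw
    exact (hw.differentiableAt (by simp)).comp (f := fun w' : V => (w', w)) e (by fun_prop)
  have A3 : ∀ᶠ w in 𝓝 e, DifferentiableAt ℝ (fun w' => n (w', w)) w := by
    have := (hn.of_le (m := 1) (by exact_mod_cast le_top)).eventually (by simp)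
    filter_upwards [cD.eventually this] with w hw
    exact (hw.differentiableAt (by simp)).comp (f := fun w' : V => (w', w)) w (by fun_prop)
  have A4 : ∀ᶠ w in 𝓝 e, ∀ᶠ w' in 𝓝 e, n (m (w', w), w) = w' := by
    have P : ∀ᶠ p in 𝓝 (e, e), n (m p, p.2) = p.1 := by
      have c1 : ContinuousAt (fun p : V × V => φ.symm p.1 * φ.symm p.2) (e, e) :=
        hs1.continuousAt.mul hs2.continuousAt
      have s1 : ∀ᶠ p : V × V in 𝓝 (e, e), φ.symm p.1 * φ.symm p.2 ∈ φ.source := by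
        refine c1 ?_
        simp only [e, hsymm, mul_one]
        exact extChartAt_source_mem_nhds (I := 𝓘(ℝ, V)) (1 : G)
      have s2 : ∀ᶠ p : V × V in 𝓝 (e, e), p.1 ∈ φ.target :=
        (continuous_fst.tendsto (e, e)).eventually A1
      filter_upwards [s1, s2] with p h1 h2
      simp only [n, m, φ.left_inv h1, mul_inv_cancel_right, φ.right_inv h2]
    filter_upwards [cL.eventually (eventually_eventually_nhds.2 P)] with w hw
    have : Tendsto (fun w' : V => (w', w)) (𝓝 e) (𝓝 (e, w)) := by
      have : Continuous (fun w' : V => (w', w)) := by fun_prop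
      exact this.tendsto e
    exact this.eventually hw
  obtain ⟨K, s, hs, hK⟩ := hL.exists_lipschitzOnWith
  obtain ⟨a₀, ha₀, hball⟩ := Metric.nhds_basis_closedBall.mem_iff.1
    (inter_mem (inter_mem (inter_mem A1 A2) (inter_mem A3 A4)) hs)
  lift a₀ to NNReal using ha₀.le
  have ha₀' : (0 : ℝ) < a₀ := ha₀
  let B : NNReal := ‖L e‖₊ + K * a₀
  have hB : ∀ w ∈ Metric.closedBall e a₀, ‖L w‖ ≤ B := by
    intro w hw
    have h1 : ‖L w - L e‖ ≤ K * ‖w - e‖ := by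
      simpa [dist_eq_norm] using
        hK.dist_le_mul w (hball hw).2 e (hball (Metric.mem_closedBall_self a₀.2)).2
    have h2 : ‖w - e‖ ≤ a₀ := by simpa [dist_eq_norm] using hw
    calc ‖L w‖ = ‖L e + (L w - L e)‖ := by congr 1; abel
      _ ≤ ‖L e‖ + ‖L w - L e‖ := norm_add_le _ _
      _ ≤ ‖L e‖ + K * a₀ := by gcongr; exact h1.trans (by gcongr)
      _ = B := by simp [B]
  refine ⟨a₀ / (B * C + 1), by positivity, fun X hX hXC a b hab hε => ?_⟩
  have hPL : IsPicardLindelof (fun t w => L w (X t)) (tmin := a) (tmax := b) ⟨a, le_rfl, hab⟩ e a₀ 0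
      (B * C) (K * C) := by
    refine ⟨fun t _ => ?_, fun w _ => ?_, fun t _ w hw => ?_, ?_⟩
    · refine LipschitzOnWith.of_dist_le_mul fun w hw w' hw' => ?_
      rw [dist_eq_norm, ← sub_apply]
      calc ‖(L w - L w') (X t)‖ ≤ ‖L w - L w'‖ * ‖X t‖ := ContinuousLinearMap.le_opNorm _ _
        _ ≤ (K * dist w w') * C := by
          gcongr
          · simpa [dist_eq_norm] using hK.dist_le_mul w (hball hw).2 w' (hball hw').2
          · exact hXC t
        _ = _ := by push_cast; ring
    · exact ((L w).continuous.comp hX).continuousOn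
    · calc ‖L w (X t)‖ ≤ ‖L w‖ * ‖X t‖ := ContinuousLinearMap.le_opNorm _ _
        _ ≤ B * C := by gcongr; exacts [hB w hw, hXC t]
        _ = _ := by push_cast; rfl
    · have h0 : max (b - a) (a - a) = b - a := by simp [hab]
      simp only [NNReal.coe_zero, sub_zero]
      rw [h0]
      push_cast
      calc (B * C : ℝ) * (b - a) ≤ (B * C + 1) * (a₀ / (B * C + 1)) := by
            gcongr; linarith
        _ = a₀ := by field_simp
  obtain ⟨α, hα⟩ := ODE.FunSpace.exists_isFixedPt_next hPL (x := e) (by simp)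
  rw [ODE.FunSpace.isFixedPt_next_iff] at hα
  let u : ℝ → V := α.compProj
  have hu_mem : ∀ t, u t ∈ Metric.closedBall e a₀ := fun t => α.compProj_mem_closedBall hPL.mul_max_le
  have hu : ∀ t ∈ Ioo a b, HasDerivAt u (L (u t) (X t)) t := by
    intro t ht
    have h1 := ODE.hasDerivWithinAt_picard_Icc (f := fun t w => L w (X t)) (u := Metric.closedBall e a₀)
      (t₀ := a) ⟨le_rfl, hab⟩ hPL.continuousOn_uncurry (α := u) α.continuous_compProj.continuousOn
      (fun t _ => hu_mem t) e (Ioo_subset_Icc_self ht)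
    have h2 := h1.hasDerivAt (Icc_mem_nhds ht.1 ht.2)
    refine h2.congr_of_eventuallyEq ?_
    filter_upwards [Icc_mem_nhds ht.1 ht.2] with s hs
    have := hα ⟨s, hs⟩
    rw [← this]
    exact ODE.FunSpace.compProj_of_mem hs
  have hcs : ContinuousOn φ.symm φ.target := continuousOn_extChartAt_symm (1 : G)
  have huc : Continuous u := α.continuous_compProj
  refine ⟨fun s => φ.symm (u s), ?_, ∅, fun t ht _ => ?_⟩
  · exact hcs.comp huc.continuousOn fun t _ => (hball (hu_mem t)).1.1.1
  · obtain ⟨⟨⟨m1, m2⟩, m3, m4⟩, -⟩ := hball (hu_mem t)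
    rw [hasRightLogDerivAt_iff]
    refine ⟨ContinuousAt.comp (g := φ.symm) (f := u) ?_ huc.continuousAt, ?_⟩
    · exact hcs.continuousAt ((isOpen_extChartAt_target (1 : G)).mem_nhds m1)
    · change HasDerivAt (fun s => n (u s, u t)) (X t) t
      have hmu : m (e, u t) = u t := by
        simp only [m, e, hsymm, one_mul]
        exact φ.right_inv m1
      have d1 : HasDerivAt (fun s => n (u s, u t))
          (fderiv ℝ (fun w' => n (w', u t)) (u t) (L (u t) (X t))) t :=
        HasFDerivAt.comp_hasDerivAt (l := fun w' => n (w', u t)) t m3.hasFDerivAt (hu t ht)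
      have d2 : HasFDerivAt (fun w' => n (m (w', u t), u t))
          ((fderiv ℝ (fun w' => n (w', u t)) (u t)).comp (L (u t))) e := by
        refine HasFDerivAt.comp (g := fun w' => n (w', u t)) (f := fun w' => m (w', u t)) e ?_
          m2.hasFDerivAt
        rw [hmu]
        exact m3.hasFDerivAt
      have d3 : HasFDerivAt (fun w' => n (m (w', u t), u t)) (ContinuousLinearMap.id ℝ V) e :=
        (hasFDerivAt_id e).congr_of_eventuallyEq m4
      have := d2.unique d3
      have := congrArg (fun T => T (X t)) this
      simp only [ContinuousLinearMap.comp_apply, ContinuousLinearMap.id_apply] at this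
      rwa [this] at d1

theorem exists_solvesOn_of_continuous [CompleteSpace V] {X : ℝ → V} (hX : Continuous X) {C : NNReal}
    (hC : ∀ t, ‖X t‖ ≤ C) {a b : ℝ} (hab : a ≤ b) : ∃ g : ℝ → G, SolvesOn X a b g := by
  obtain ⟨ε, hε, h⟩ := exists_solvesOn_short G (V := V) C
  have key : ∀ N : ℕ, ∀ b, a ≤ b → b - a ≤ N * ε → ∃ g : ℝ → G, SolvesOn X a b g := by
    intro N
    induction N with
    | zero => exact fun b hab hb => h X hX hC a b hab (by simp at hb; linarith)
    | succ N ih =>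
      intro b hab hb
      push_cast at hb
      rcases le_total (b - a) ε with h1 | h1
      · exact h X hX hC a b hab h1
      · exact exists_solvesOn_trans (ih (b - ε) (by linarith) (by linarith))
          (h X hX hC (b - ε) b (by linarith) (by linarith))
  obtain ⟨N, hN⟩ := exists_nat_ge ((b - a) / ε)
  exact key N b hab (by rwa [div_le_iff₀ hε] at hN)

/-- Existence for a vector field that is continuous on the closed pieces of a finite partition. -/
theorem exists_solvesOn_of_pieces {X : ℝ → V} (F : Finset ℝ) : ∀ {a b : ℝ}, a ≤ b →
    (∀ c d, a ≤ c → c ≤ d → d ≤ b → (∀ x ∈ F, x ∉ Ioo c d) → ∃ g : ℝ → G, SolvesOn X c d g) →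
    ∃ g : ℝ → G, SolvesOn X a b g := by
  induction F using Finset.induction_on with
  | empty => exact fun hab h => h _ _ le_rfl hab le_rfl (by simp)
  | insert x F hx ih =>
    intro a b hab h
    by_cases hxab : x ∈ Ioo a b
    · refine exists_solvesOn_trans (b := x) (ih hxab.1.le fun c d h1 h2 h3 h4 => ?_)
        (ih hxab.2.le fun c d h1 h2 h3 h4 => ?_)
      · refine h c d h1 h2 (h3.trans hxab.2.le) fun y hy => ?_
        rcases Finset.mem_insert.1 hy with rfl | hy
        · exact fun hh => absurd hh.2 (not_lt.2 h3)
        · exact h4 y hy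
      · refine h c d (hxab.1.le.trans h1) h2 h3 fun y hy => ?_
        rcases Finset.mem_insert.1 hy with rfl | hy
        · exact fun hh => absurd hh.1 (not_lt.2 h1)
        · exact h4 y hy
    · refine ih hab fun c d h1 h2 h3 h4 => h c d h1 h2 h3 fun y hy => ?_
      rcases Finset.mem_insert.1 hy with rfl | hy
      · exact fun hh => hxab ⟨h1.trans_lt hh.1, hh.2.trans_le h3⟩
      · exact h4 y hy

theorem exists_solvesOn_of_continuousOn [CompleteSpace V] {X Y : ℝ → V} {a b : ℝ} (hab : a ≤ b)
    (hY : ContinuousOn Y (Icc a b)) (h : ∀ t ∈ Ioo a b, X t = Y t) :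
    ∃ g : ℝ → G, SolvesOn X a b g := by
  have hc : Continuous (IccExtend hab (fun t : Icc a b => Y t)) :=
    (continuousOn_iff_continuous_domRestrict.1 hY).Icc_extend'
  obtain ⟨C, hC⟩ := isCompact_Icc.exists_bound_of_continuousOn hY
  obtain ⟨g, hg⟩ := exists_solvesOn_of_continuous (G := G) hc (C := C.toNNReal) (fun t => by
    refine (hC _ (projIcc a b hab t).2).trans (Real.le_coe_toNNReal C)) hab
  refine ⟨g, hg.congr ∅ fun t ht _ => ?_⟩
  rw [h t ht, IccExtend_of_mem hab _ (Ioo_subset_Icc_self ht)]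

end LieTransport

section PiecewiseAnalytic

variable {E : Type*} [NormedAddCommGroup E] [NormedSpace ℝ E]
  {M : Type*} [TopologicalSpace M] [ChartedSpace E M]

variable (E) in
/-- A continuous path (parametrized by `[0, 1]`) is piecewise analytic if there is a finite set `F`
of break points such that it is real-analytic on every closed subinterval of `[0, 1]` without
break points in its interior. -/
def IsPiecewiseAnalytic {x y : M} (γ : Path x y) : Prop :=
  ∃ F : Finset ℝ, ∀ a b : ℝ, 0 ≤ a → b ≤ 1 → (∀ t ∈ F, t ∉ Ioo a b) →
    ContMDiffOn 𝓘(ℝ, ℝ) 𝓘(ℝ, E) ω γ.extend (Icc a b)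

theorem contMDiffOn_affine_comp {f h : ℝ → M} {a b p q c d : ℝ}
    (hf : ContMDiffOn 𝓘(ℝ, ℝ) 𝓘(ℝ, E) ω f (Icc c d))
    (hI : ∀ t ∈ Icc a b, p * t + q ∈ Icc c d) (he : ∀ t ∈ Icc a b, h t = f (p * t + q)) :
    ContMDiffOn 𝓘(ℝ, ℝ) 𝓘(ℝ, E) ω h (Icc a b) := by
  have haff : ContMDiff 𝓘(ℝ, ℝ) 𝓘(ℝ, ℝ) ω (fun t : ℝ => p * t + q) := by
    have : ContDiff ℝ ω (fun t : ℝ => p * t + q) := by fun_prop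
    exact this.contMDiff
  exact (hf.comp haff.contMDiffOn hI).congr he

theorem IsPiecewiseAnalytic.refl (x : M) : IsPiecewiseAnalytic E (Path.refl x) :=
  ⟨∅, fun _ _ _ _ _ => contMDiffOn_const (c := x)⟩

theorem IsPiecewiseAnalytic.symm {x y : M} {γ : Path x y} (h : IsPiecewiseAnalytic E γ) :
    IsPiecewiseAnalytic E γ.symm := by
  obtain ⟨F, hF⟩ := h
  refine ⟨F.image (fun t => 1 - t), fun a b ha hb hab => ?_⟩
  refine contMDiffOn_affine_comp (p := -1) (q := 1)
    (hF (1 - b) (1 - a) (by linarith) (by linarith) fun t ht htI => ?_)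
    (fun t ht => ⟨by linarith [ht.2], by linarith [ht.1]⟩) (fun t _ => ?_)
  · exact hab (1 - t) (Finset.mem_image_of_mem _ ht) ⟨by linarith [htI.2], by linarith [htI.1]⟩
  · rw [Path.extend_symm_apply]
    congr 1
    ring

theorem IsPiecewiseAnalytic.trans {x y z : M} {γ : Path x y} {δ : Path y z}
    (h : IsPiecewiseAnalytic E γ) (h' : IsPiecewiseAnalytic E δ) :
    IsPiecewiseAnalytic E (γ.trans δ) := by
  obtain ⟨F, hF⟩ := h
  obtain ⟨F', hF'⟩ := h'
  refine ⟨insert (1 / 2) (F.image (fun t => t / 2) ∪ F'.image (fun t => (t + 1) / 2)),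
    fun a b ha hb hab => ?_⟩
  have hhalf : ¬ (a < 1 / 2 ∧ 1 / 2 < b) := hab (1 / 2) (by simp)
  rcases lt_or_ge a (1 / 2) with h1 | h1
  · have h2 : b ≤ 1 / 2 := not_lt.1 fun h => hhalf ⟨h1, h⟩
    refine contMDiffOn_affine_comp (p := 2) (q := 0)
      (hF (2 * a) (2 * b) (by linarith) (by linarith) fun t ht htI => ?_)
      (fun t ht => ⟨by linarith [ht.1], by linarith [ht.2]⟩) (fun t ht => ?_)
    · refine hab (t / 2) ?_ ⟨by linarith [htI.1], by linarith [htI.2]⟩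
      simp only [Finset.mem_insert, Finset.mem_union, Finset.mem_image]
      exact .inr (.inl ⟨t, ht, rfl⟩)
    · rw [Path.extend_trans_of_le_half _ _ (ht.2.trans h2), add_zero]
  · refine contMDiffOn_affine_comp (p := 2) (q := -1)
      (hF' (2 * a - 1) (2 * b - 1) (by linarith) (by linarith) fun t ht htI => ?_)
      (fun t ht => ⟨by linarith [ht.1], by linarith [ht.2]⟩) (fun t ht => ?_)
    · refine hab ((t + 1) / 2) ?_ ⟨by linarith [htI.1], by linarith [htI.2]⟩
      simp only [Finset.mem_insert, Finset.mem_union, Finset.mem_image]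
      exact .inr (.inr ⟨t, ht, rfl⟩)
    · rw [Path.extend_trans_of_half_le _ _ (h1.trans ht.1), ← sub_eq_add_neg]

theorem IsPiecewiseAnalytic.mdifferentiableAt {x y : M} {γ : Path x y} {F : Finset ℝ}
    (hF : ∀ a b : ℝ, 0 ≤ a → b ≤ 1 → (∀ t ∈ F, t ∉ Ioo a b) →
      ContMDiffOn 𝓘(ℝ, ℝ) 𝓘(ℝ, E) ω γ.extend (Icc a b)) {t : ℝ} (ht : t ∈ Ioo (0 : ℝ) 1)
    (htF : t ∉ F) : MDifferentiableAt 𝓘(ℝ, ℝ) 𝓘(ℝ, E) γ.extend t := by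
  have hnhds : Ioo (0 : ℝ) 1 ∩ (F : Set ℝ)ᶜ ∈ 𝓝 t :=
    inter_mem (Ioo_mem_nhds ht.1 ht.2) (F.finite_toSet.isClosed.isOpen_compl.mem_nhds htF)
  obtain ⟨a, b, htab, hnb, hab⟩ := exists_Icc_mem_subset_of_mem_nhds hnhds
  have hle : a ≤ b := htab.1.trans htab.2
  have h := hF a b (hab ⟨le_rfl, hle⟩).1.1.le (hab ⟨hle, le_rfl⟩).1.2.le
    fun s hs hsI => (hab (Ioo_subset_Icc_self hsI)).2 hs
  exact (h.contMDiffAt hnb).mdifferentiableAt (by simp)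

end PiecewiseAnalytic

section Loops

variable {E : Type*} [NormedAddCommGroup E] [NormedSpace ℝ E]
  {M : Type*} [TopologicalSpace M] [ChartedSpace E M] [IsManifold 𝓘(ℝ, E) ω M]
  {V : Type*} [NormedAddCommGroup V] [NormedSpace ℝ V]
  {G : Type*} [TopologicalSpace G] [ChartedSpace V G] [Group G]

variable (E M V G) in
/-- A smooth 1-form on `M` with values in the Lie algebra of `G`: a linear map on each tangent
space, such that the resulting map `TM → Lie G` is smooth. -/
structure LieAlgebraForm where
  /-- the linear map on the tangent space at `x` -/
  toFun : ∀ x : M, TangentSpace 𝓘(ℝ, E) x →L[ℝ] GroupLieAlgebra 𝓘(ℝ, V) G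
  smooth : ContMDiff (M' := V) 𝓘(ℝ, E).tangent 𝓘(ℝ, V) ∞
    (fun v : TangentBundle 𝓘(ℝ, E) M => toFun v.proj v.2)

/-- The value `A(γ'(t))` of a Lie algebra valued 1-form on the velocity of a curve. -/
def LieAlgebraForm.along (A : LieAlgebraForm E M V G) (γ : ℝ → M) (t : ℝ) : V :=
  A.toFun (γ t) (mfderiv 𝓘(ℝ, ℝ) 𝓘(ℝ, E) γ t (1 : ℝ))

theorem LieAlgebraForm.along_comp_affine (A : LieAlgebraForm E M V G) {f γ : ℝ → M} {p q t : ℝ}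
    (hf : f =ᶠ[𝓝 t] fun s => γ (p * s + q))
    (hγ : MDifferentiableAt 𝓘(ℝ, ℝ) 𝓘(ℝ, E) γ (p * t + q)) :
    A.along f t = p • A.along γ (p * t + q) := by
  have haff : HasMFDerivAt 𝓘(ℝ, ℝ) 𝓘(ℝ, ℝ) (fun s : ℝ => p * s + q) t
      (ContinuousLinearMap.toSpanSingleton ℝ p) := by
    have : HasDerivAt (fun s : ℝ => p * s + q) p t := by
      simpa using ((hasDerivAt_id t).const_mul p).add_const q
    exact (hasDerivAt_iff_hasFDerivAt.1 this).hasMFDerivAt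
  have hcomp := (HasMFDerivAt.comp (g := γ) t hγ.hasMFDerivAt haff).congr_of_eventuallyEq hf
  have h1 := hcomp.mfderiv
  let T : M → E → V := fun x w => A.toFun x w
  let D : ℝ →L[ℝ] E := mfderiv 𝓘(ℝ, ℝ) 𝓘(ℝ, E) γ (p * t + q)
  have h2 : (mfderiv 𝓘(ℝ, ℝ) 𝓘(ℝ, E) f t (1 : ℝ) : E) = p • D 1 := by
    rw [h1]
    change D ((1 : ℝ) • p) = p • D 1
    rw [← map_smul]
    congr 1
    simp
  change T (f t) (mfderiv 𝓘(ℝ, ℝ) 𝓘(ℝ, E) f t (1 : ℝ)) = p • T (γ (p * t + q)) (D 1)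
  rw [h2, hf.eq_of_nhds]
  exact (A.toFun (γ (p * t + q))).map_smul p (D 1)

variable [LieGroup 𝓘(ℝ, V) ∞ G] [FiniteDimensional ℝ V]

/-- Parallel transport exists: the equation `g' = A(γ') g` is solvable along `γ`. -/
theorem exists_transport (A : LieAlgebraForm E M V G) {x y : M} {γ : Path x y}
    (h : IsPiecewiseAnalytic E γ) :
    ∃ g : ℝ → G, g 0 = 1 ∧ SolvesOn (A.along γ.extend) 0 1 g := by
  have := FiniteDimensional.complete ℝ V
  obtain ⟨F, hF⟩ := h
  suffices ∃ g : ℝ → G, SolvesOn (A.along γ.extend) 0 1 g by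
    obtain ⟨g, hg⟩ := this
    exact ⟨_, mul_inv_cancel (g 0), hg.mul_right _⟩
  refine exists_solvesOn_of_pieces F zero_le_one fun c d hc hcd hd hcdF => ?_
  rcases hcd.eq_or_lt with rfl | hlt
  · exact ⟨fun _ => 1, continuousOn_const, ∅, by simp⟩
  have han := hF c d hc hd hcdF
  have huniq : UniqueMDiffOn 𝓘(ℝ, ℝ) (Icc c d) :=
    uniqueMDiffOn_iff_uniqueDiffOn.2 (uniqueDiffOn_Icc hlt)
  have htan := han.continuousOn_tangentMapWithin (by simp) huniq
  have hsec : Continuous (fun t : ℝ => (⟨t, (1 : ℝ)⟩ : TangentBundle 𝓘(ℝ, ℝ) ℝ)) :=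
    (tangentBundleModelSpaceHomeomorph 𝓘(ℝ, ℝ)).symm.continuous.comp
      (Continuous.prodMk continuous_id (continuous_const (y := (1 : ℝ))))
  have hY := A.smooth.continuous.comp_continuousOn
    (htan.comp (f := fun t : ℝ => (⟨t, (1 : ℝ)⟩ : TangentBundle 𝓘(ℝ, ℝ) ℝ)) (s := Icc c d)
      hsec.continuousOn (fun t ht => ht))
  refine exists_solvesOn_of_continuousOn hlt.le hY fun t ht => ?_
  have hmd : MDifferentiableAt 𝓘(ℝ, ℝ) 𝓘(ℝ, E) γ.extend t :=
    (han.contMDiffAt (Icc_mem_nhds ht.1 ht.2)).mdifferentiableAt (by simp)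
  have := tangentMapWithin_eq_tangentMap (p := (⟨t, (1 : ℝ)⟩ : TangentBundle 𝓘(ℝ, ℝ) ℝ))
    (huniq t (Ioo_subset_Icc_self ht)) hmd
  change A.along γ.extend t = (fun v : TangentBundle 𝓘(ℝ, E) M => (A.toFun v.proj v.2 : V))
    (tangentMapWithin 𝓘(ℝ, ℝ) 𝓘(ℝ, E) γ.extend (Icc c d) ⟨t, (1 : ℝ)⟩)
  rw [this]
  rfl

/-- The path-ordered exponential `P exp ∫_γ A`: the value at time `1` of the solution of
`g' = A(γ') g`, `g(0) = 1`. -/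
def holonomy (A : LieAlgebraForm E M V G) {x y : M} (γ : Path x y)
    (h : IsPiecewiseAnalytic E γ) : G :=
  (exists_transport A h).choose 1

variable [T2Space G]

theorem holonomy_eq (A : LieAlgebraForm E M V G) {x y : M} {γ : Path x y}
    (h : IsPiecewiseAnalytic E γ) {g : ℝ → G} (hg : SolvesOn (A.along γ.extend) 0 1 g) :
    holonomy A γ h = g 1 * (g 0)⁻¹ := by
  have := FiniteDimensional.complete ℝ V
  obtain ⟨h0, hs⟩ := (exists_transport A h).choose_spec
  exact hs.unique (hg.mul_right (g 0)⁻¹) (by simp [h0]) 1 ⟨zero_le_one, le_rfl⟩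

theorem holonomy_trans (A : LieAlgebraForm E M V G) {x y z : M} {γ : Path x y} {δ : Path y z}
    (h : IsPiecewiseAnalytic E γ) (h' : IsPiecewiseAnalytic E δ) :
    holonomy A (γ.trans δ) (h.trans h') = holonomy A δ h' * holonomy A γ h := by
  obtain ⟨g, g0, hg⟩ := exists_transport A h
  obtain ⟨k, k0, hk⟩ := exists_transport A h'
  rw [holonomy_eq A h hg, holonomy_eq A h' hk]
  obtain ⟨F, hF⟩ := h
  obtain ⟨F', hF'⟩ := h'
  have s1 : SolvesOn (A.along (γ.trans δ).extend) 0 (1 / 2) (fun s => g (2 * s + 0)) := by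
    refine hg.comp_affine two_ne_zero (fun t ht => ⟨by linarith [ht.1], by linarith [ht.2]⟩)
      (fun t ht => ⟨by linarith [ht.1], by linarith [ht.2]⟩) (F.image (fun t => t / 2))
      fun t ht htF => ?_
    refine A.along_comp_affine ?_ (IsPiecewiseAnalytic.mdifferentiableAt hF
      ⟨by linarith [ht.1], by linarith [ht.2]⟩ fun hmem => htF ?_)
    · filter_upwards [Iio_mem_nhds ht.2] with s hs
      rw [Path.extend_trans_of_le_half _ _ (le_of_lt (mem_Iio.1 hs)), add_zero]
    · exact Finset.mem_image.2 ⟨_, hmem, by ring⟩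
  have s2 : SolvesOn (A.along (γ.trans δ).extend) (1 / 2) 1 (fun s => k (2 * s + -1)) := by
    refine hk.comp_affine two_ne_zero (fun t ht => ⟨by linarith [ht.1], by linarith [ht.2]⟩)
      (fun t ht => ⟨by linarith [ht.1], by linarith [ht.2]⟩) (F'.image (fun t => (t + 1) / 2))
      fun t ht htF => ?_
    refine A.along_comp_affine ?_ (IsPiecewiseAnalytic.mdifferentiableAt hF'
      ⟨by linarith [ht.1], by linarith [ht.2]⟩ fun hmem => htF ?_)
    · filter_upwards [Ioi_mem_nhds ht.1] with s hs
      rw [Path.extend_trans_of_half_le _ _ (le_of_lt (mem_Ioi.1 hs)), ← sub_eq_add_neg]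
    · exact Finset.mem_image.2 ⟨_, hmem, by ring⟩
  have s3 := s1.glue (s2.mul_right (g 1)) (by norm_num [k0])
  rw [holonomy_eq A _ s3]
  norm_num [g0, k0]

theorem holonomy_symm (A : LieAlgebraForm E M V G) {x y : M} {γ : Path x y}
    (h : IsPiecewiseAnalytic E γ) :
    holonomy A γ.symm h.symm = (holonomy A γ h)⁻¹ := by
  obtain ⟨g, g0, hg⟩ := exists_transport A h
  rw [holonomy_eq A h hg]
  obtain ⟨F, hF⟩ := h
  have s1 : SolvesOn (A.along γ.symm.extend) 0 1 (fun s => g (-1 * s + 1)) := by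
    refine hg.comp_affine (by norm_num) (fun t ht => ⟨by linarith [ht.2], by linarith [ht.1]⟩)
      (fun t ht => ⟨by linarith [ht.2], by linarith [ht.1]⟩) (F.image (fun t => 1 - t))
      fun t ht htF => ?_
    refine A.along_comp_affine (.of_forall fun s => ?_) (IsPiecewiseAnalytic.mdifferentiableAt hF
      ⟨by linarith [ht.2], by linarith [ht.1]⟩ fun hmem => htF ?_)
    · rw [Path.extend_symm_apply]
      congr 1
      ring
    · exact Finset.mem_image.2 ⟨_, hmem, by ring⟩
  rw [holonomy_eq A _ s1]
  simp [g0]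

theorem holonomy_refl (A : LieAlgebraForm E M V G) (x : M) :
    holonomy A (Path.refl x) (IsPiecewiseAnalytic.refl x) = 1 := by
  have h := holonomy_trans A (IsPiecewiseAnalytic.refl (E := E) x) (IsPiecewiseAnalytic.refl x)
  simp only [Path.refl_trans_refl] at h
  exact left_eq_mul.1 h

end Loops

section HoopGroup

variable {E : Type*} [NormedAddCommGroup E] [NormedSpace ℝ E]
  {M : Type*} [TopologicalSpace M] [ChartedSpace E M]

variable (E) in
/-- The continuous, piecewise analytic loops based at `x₀`. -/
def Loop (x₀ : M) : Type _ := {γ : Path x₀ x₀ // IsPiecewiseAnalytic E γ}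

/-- The constant loop. -/
def Loop.const (x₀ : M) : Loop E x₀ := ⟨Path.refl x₀, .refl x₀⟩

/-- The reversed loop `s ↦ γ(1 - s)`. -/
def Loop.inv {x₀ : M} (α : Loop E x₀) : Loop E x₀ := ⟨α.1.symm, α.2.symm⟩

/-- The composition `α ∘ β` : first `β`, then `α`, each at double speed. -/
def Loop.comp {x₀ : M} (α β : Loop E x₀) : Loop E x₀ := ⟨β.1.trans α.1, β.2.trans α.2⟩

/-- A family of loops is independent if each of them contains an open segment which it traverses
only once and which meets each of the other loops in at most finitely many points. -/
def IndependentLoops {x₀ : M} {n : ℕ} (α : Fin n → Loop E x₀) : Prop :=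
  ∀ i, ∃ a b : ℝ, 0 ≤ a ∧ a < b ∧ b ≤ 1 ∧
    (∀ t ∈ Ioo a b, ∀ s ∈ Icc (0 : ℝ) 1, (α i).1.extend s = (α i).1.extend t → s = t) ∧
    ∀ j, j ≠ i → ((α i).1.extend '' Ioo a b ∩ range (α j).1).Finite

variable [IsManifold 𝓘(ℝ, E) ω M]
  {V : Type*} [NormedAddCommGroup V] [NormedSpace ℝ V] [FiniteDimensional ℝ V]
  {G : Type*} [TopologicalSpace G] [T2Space G] [ChartedSpace V G] [Group G] [LieGroup 𝓘(ℝ, V) ∞ G]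

variable (E V G) in
/-- Two loops are `G`-holonomy equivalent if every smooth Lie algebra valued 1-form has the same
holonomy along both. -/
def holonomySetoid (x₀ : M) : Setoid (Loop E x₀) where
  r α β := ∀ A : LieAlgebraForm E M V G, holonomy A α.1 α.2 = holonomy A β.1 β.2
  iseqv := ⟨fun _ _ => rfl, fun h A => (h A).symm, fun h h' A => (h A).trans (h' A)⟩

variable (E V G) in
/-- The set of hoops: classes of `G`-holonomy equivalent loops. -/
def HoopGroup (x₀ : M) : Type _ := Quotient (holonomySetoid E V G x₀)

variable (V G) in
/-- The hoop represented by a loop. -/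
def Loop.hoop {x₀ : M} (α : Loop E x₀) : HoopGroup E V G x₀ := Quotient.mk _ α

/-- Hoops form a group under composition of loops; the inverse is given by reversing loops. -/
instance (x₀ : M) : Group (HoopGroup E V G x₀) :=
  letI : Mul (HoopGroup E V G x₀) :=
    ⟨Quotient.map₂ Loop.comp fun α α' h β β' h' A => by
      change holonomy A (β.1.trans α.1) (β.2.trans α.2) =
        holonomy A (β'.1.trans α'.1) (β'.2.trans α'.2)
      rw [holonomy_trans A β.2 α.2, holonomy_trans A β'.2 α'.2, h A, h' A]⟩
  letI : One (HoopGroup E V G x₀) := ⟨(Loop.const x₀).hoop V G⟩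
  letI : Inv (HoopGroup E V G x₀) :=
    ⟨Quotient.map Loop.inv fun α α' h A => by
      change holonomy A α.1.symm α.2.symm = holonomy A α'.1.symm α'.2.symm
      rw [holonomy_symm A α.2, holonomy_symm A α'.2, h A]⟩
  Group.ofLeftAxioms
    (by
      rintro ⟨α⟩ ⟨β⟩ ⟨γ⟩
      refine Quotient.sound fun A => ?_
      change holonomy A (γ.1.trans (β.1.trans α.1)) (γ.2.trans (β.2.trans α.2)) =
        holonomy A ((γ.1.trans β.1).trans α.1) ((γ.2.trans β.2).trans α.2)
      rw [holonomy_trans A γ.2 (β.2.trans α.2), holonomy_trans A β.2 α.2,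
        holonomy_trans A (γ.2.trans β.2) α.2, holonomy_trans A γ.2 β.2, mul_assoc])
    (by
      rintro ⟨α⟩
      refine Quotient.sound fun A => ?_
      change holonomy A (α.1.trans (Path.refl x₀)) (α.2.trans (.refl x₀)) = holonomy A α.1 α.2
      rw [holonomy_trans A α.2 (.refl x₀), holonomy_refl, one_mul])
    (by
      rintro ⟨α⟩
      refine Quotient.sound fun A => ?_
      change holonomy A (α.1.trans α.1.symm) (α.2.trans α.2.symm) =
        holonomy A (Path.refl x₀) (.refl x₀)
      rw [holonomy_trans A α.2 α.2.symm, holonomy_symm A α.2, holonomy_refl, inv_mul_cancel])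

theorem Loop.hoop_comp {x₀ : M} (α β : Loop E x₀) :
    (α.comp β).hoop V G = α.hoop V G * β.hoop V G := rfl

theorem Loop.hoop_inv {x₀ : M} (α : Loop E x₀) : α.inv.hoop V G = (α.hoop V G)⁻¹ := rfl

theorem Loop.hoop_const (x₀ : M) : (Loop.const x₀ : Loop E x₀).hoop V G = 1 := rfl

/-- A family of hoops is independent if the hoops have representatives that form an independent
family of loops. -/
def IndependentHoops {x₀ : M} {n : ℕ} (β : Fin n → HoopGroup E V G x₀) : Prop :=
  ∃ α : Fin n → Loop E x₀, (∀ i, (α i).hoop V G = β i) ∧ IndependentLoops α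

/-- A subgroup of the hoop group is tame if it is generated by finitely many independent hoops. -/
def IsTame {x₀ : M} (S : Subgroup (HoopGroup E V G x₀)) : Prop :=
  ∃ (n : ℕ) (β : Fin n → HoopGroup E V G x₀), IndependentHoops β ∧ S = Subgroup.closure (range β)

variable (E V G) in
/-- The label set: the tame subgroups of the hoop group, ordered by inclusion. -/
abbrev TameSubgroup (x₀ : M) : Type _ := {S : Subgroup (HoopGroup E V G x₀) // IsTame S}

/-- The projective limit of a family of sets `X S` with maps `p h : X S' → X S` for `S ≤ S'`: the
subset of the product consisting of the consistent families. -/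
def projectiveLimit {L : Type*} [Preorder L] (X : L → Type*)
    (p : ∀ ⦃S S' : L⦄, S ≤ S' → X S' → X S) : Set (∀ S, X S) :=
  {x | ∀ ⦃S S' : L⦄ (h : S ≤ S'), p h (x S') = x S}

/-- The restriction map `Hom(S', G) → Hom(S, G)` for tame subgroups `S ≤ S'`. -/
def homRestrict {x₀ : M} ⦃S S' : TameSubgroup E V G x₀⦄ (h : S ≤ S') (f : S'.1 →* G) : S.1 →* G :=
  f.comp (Subgroup.inclusion h)

variable (E V G) in
/-- The projective limit of the family of the sets `Hom(S, G)`, with `S` ranging over the tame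
subgroups, and the restriction maps. -/
def hoopProjectiveLimit (x₀ : M) : Set (∀ S : TameSubgroup E V G x₀, S.1 →* G) :=
  projectiveLimit (fun S : TameSubgroup E V G x₀ => S.1 →* G) homRestrict

variable (E V G) in
/-- The map `H ↦ (H|_S)_S` from `Hom(HG, G)` to the projective limit. -/
def restrictionMap (x₀ : M) (H : HoopGroup E V G x₀ →* G) : hoopProjectiveLimit E V G x₀ :=
  ⟨fun S => H.comp S.1.subtype, fun _ _ _ => rfl⟩

end HoopGroup

end
end Hoop

/-!
The theorem reduces to the fact that every finite set of hoops lies in a tame subgroup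
(`exists_isTame_of_finite`). This makes the tame subgroups directed, with union the whole hoop
group, so a homomorphism on the hoop group is determined by its restrictions to them, and a
consistent family of homomorphisms glues to one.

Finitely many loops are first cut into constant pieces and injective, regular analytic arcs
(`IsPiecewiseAnalytic.exists_pieces`). Analyticity enters a second time when arcs intersect: two
analytic half-curves that issue from one point and meet again arbitrarily close to it have the same
germ (`analytic_germ_subset`). By compactness each arc has a finite subdivision whose pieces lie
inside or outside any other arc, so the arcs can be cut further into a finite graph, in which two
arcs have the same interior or meet at most in their end points (`exists_graph`). Arcs with the same
interior differ by a change of parameter, which is differentiable in the interior, hence they have the same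
parallel transports up to inversion (`IsArc.transport_eq_or`).

In the graph, let `D` be a maximal tree at the base point. For each arc `e` outside `D` whose end
points are reached by `D`, take the loop that runs through `D` to `e`, along `e`, and back through
`D`. No other such loop meets the interior of `e`, so these loops are independent
(`exists_independent_generators`); and since retraced tree paths cancel in every holonomy, the given
loops are products of them up to holonomy equivalence (`exists_isTame_of_loops`).
-/

namespace Hoop

noncomputable section

/-! ### Germs of analytic curves -/

/-- A non-trivial real-analytic germ `a` with `a 0 = 0` is `± A ^ k` for an increasing analytic
coordinate `A` at `0`; the function `B` is the analytic inverse of `A`. -/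
theorem exists_analytic_coordinate {a : ℝ → ℝ} (ha : AnalyticAt ℝ a 0) (h0 : a 0 = 0)
    (hne : ¬ ∀ᶠ t in 𝓝 0, a t = 0) :
    ∃ (k : ℕ) (σ : ℝ) (A B : ℝ → ℝ), k ≠ 0 ∧ (σ = 1 ∨ σ = -1) ∧ AnalyticAt ℝ A 0 ∧
      AnalyticAt ℝ B 0 ∧ A 0 = 0 ∧ B 0 = 0 ∧ (∀ᶠ t in 𝓝 0, a t = σ * A t ^ k) ∧
      (∀ᶠ t in 𝓝 0, B (A t) = t) ∧ (∀ᶠ t in 𝓝 0, A (B t) = t) ∧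
      (∀ᶠ t in 𝓝 0, 0 < t → 0 < A t) ∧ ∀ᶠ t in 𝓝 0, 0 < t → 0 < B t := by
  obtain ⟨k, g, hg, hg0, hag⟩ := ha.exists_eventuallyEq_pow_smul_nonzero_iff.2 hne
  have hk : k ≠ 0 := by
    rintro rfl
    have := hag.self_of_nhds
    simp only [h0, pow_zero, one_smul] at this
    exact hg0 this.symm
  obtain ⟨σ, hσ, hσg⟩ : ∃ σ : ℝ, (σ = 1 ∨ σ = -1) ∧ 0 < σ * g 0 := by
    rcases lt_or_gt_of_ne hg0 with h | h
    · exact ⟨-1, .inr rfl, by linarith⟩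
    · exact ⟨1, .inl rfl, by linarith⟩
  have hσσ : σ * σ = 1 := by rcases hσ with rfl | rfl <;> norm_num
  let r : ℝ → ℝ := fun t => (σ * g t) ^ ((k : ℝ)⁻¹)
  have hσga : AnalyticAt ℝ (fun t => σ * g t) 0 := analyticAt_const.mul hg
  have hr : AnalyticAt ℝ r 0 := (hσga.contDiffAt.rpow_const_of_ne hσg.ne' (n := ω)).analyticAt
  have hpos : ∀ᶠ t in 𝓝 0, 0 < σ * g t := hσga.continuousAt.eventually (lt_mem_nhds hσg)
  have hrpos : ∀ᶠ t in 𝓝 0, 0 < r t := by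
    filter_upwards [hpos] with t ht using Real.rpow_pos_of_pos ht _
  have hA : AnalyticAt ℝ (fun t => t * r t) 0 := analyticAt_id.mul hr
  have hd : HasDerivAt (fun t => t * r t) (r 0) 0 := by
    simpa using (hasDerivAt_id' (0 : ℝ)).fun_mul hr.differentiableAt.hasDerivAt
  have hd0 : deriv (fun t => t * r t) 0 ≠ 0 := by
    rw [hd.deriv]; exact hrpos.self_of_nhds.ne'
  have hst := hA.hasStrictDerivAt
  let B : ℝ → ℝ := hst.localInverse _ _ _ hd0
  have hB : AnalyticAt ℝ B 0 := by simpa using hA.analyticAt_localInverse hd0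
  have hl : ∀ᶠ t in 𝓝 0, B (t * r t) = t :=
    HasStrictFDerivAt.eventually_left_inverse (hst.hasStrictFDerivAt_equiv hd0)
  have hr' : ∀ᶠ t in 𝓝 0, B t * r (B t) = t := by
    simpa using HasStrictFDerivAt.eventually_right_inverse (hst.hasStrictFDerivAt_equiv hd0)
  have hB0 : B 0 = 0 := by simpa using hl.self_of_nhds
  have hBt : Tendsto B (𝓝 0) (𝓝 0) := by simpa only [hB0] using hB.continuousAt.tendsto
  refine ⟨k, σ, fun t => t * r t, B, hk, hσ, hA, hB, by simp, hB0, ?_, hl, hr', ?_, ?_⟩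
  · filter_upwards [hag, hpos] with t h1 h2
    rw [h1, mul_pow, Real.rpow_inv_natCast_pow h2.le hk, sub_zero, smul_eq_mul]
    linear_combination (-(t ^ k * g t)) * hσσ
  · filter_upwards [hrpos] with t h1 h2 using mul_pos h2 h1
  · filter_upwards [hr', hBt.eventually hrpos] with t h1 h2 h3
    exact pos_of_mul_pos_left (h1.symm ▸ h3) h2.le

/-- A non-constant analytic curve germ has a non-constant linear coordinate. -/
theorem exists_functional_not_eventually_zero {E : Type*} [NormedAddCommGroup E] [NormedSpace ℝ E]
    {f : ℝ → E} (hf : AnalyticAt ℝ f 0) (hne : ¬ ∀ᶠ t in 𝓝 0, f t = f 0) :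
    ∃ l : E →L[ℝ] ℝ, ¬ ∀ᶠ t in 𝓝 0, l (f t - f 0) = 0 := by
  have hf' : AnalyticAt ℝ (fun t => f t - f 0) 0 := hf.sub analyticAt_const
  obtain ⟨n, h, hh, hh0, hfh⟩ := hf'.exists_eventuallyEq_pow_smul_nonzero_iff.2
    (by simpa only [sub_eq_zero] using hne)
  obtain ⟨l, hl⟩ := SeparatingDual.exists_ne_zero (R := ℝ) hh0
  refine ⟨l, fun hz => ?_⟩
  have hc : ContinuousAt (fun t => l (h t)) 0 := l.continuous.continuousAt.comp hh.continuousAt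
  have hev : ∀ᶠ t in 𝓝[≠] (0 : ℝ), False := by
    filter_upwards [hz.filter_mono nhdsWithin_le_nhds, hfh.filter_mono nhdsWithin_le_nhds,
      (hc.eventually_ne hl).filter_mono nhdsWithin_le_nhds, self_mem_nhdsWithin] with t h1 h2 h3 h4
    rw [h2, map_smul, smul_eq_mul, sub_zero] at h1
    exact mul_ne_zero (pow_ne_zero n h4) h3 h1
  exact hev.exists.elim fun _ h => h

/-- If two analytic half-curves issuing from the same point meet again arbitrarily close to it,
then the germ of the first is contained in the second. After choosing coordinates along the curves
in which a linear functional becomes `± u ^ k` and `± v ^ m`, both curves become analytic functions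
of a common parameter `w`, where `u = w ^ m` and `v = w ^ k`, and the identity theorem applies. -/
theorem analytic_germ_subset {E : Type*} [NormedAddCommGroup E] [NormedSpace ℝ E]
    {f g : ℝ → E} (hf : AnalyticAt ℝ f 0) (hg : AnalyticAt ℝ g 0)
    (h0 : f 0 = g 0) (hne : ¬ ∀ᶠ t in 𝓝 0, f t = f 0)
    (hfreq : ∀ ε > 0, ∃ t ∈ Ioo 0 ε, ∃ s ∈ Ioo 0 ε, f t = g s) {η : ℝ} (hη : 0 < η) :
    ∃ ε > 0, ∀ t ∈ Ioo 0 ε, ∃ s ∈ Ioo 0 η, f t = g s := by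
  obtain ⟨l, hl⟩ := exists_functional_not_eventually_zero hf hne
  have hla : AnalyticAt ℝ (fun t => l (f t - f 0)) 0 :=
    (l.analyticAt _).comp (hf.sub analyticAt_const)
  have hlb : AnalyticAt ℝ (fun s => l (g s - f 0)) 0 :=
    (l.analyticAt _).comp (hg.sub analyticAt_const)
  -- small parameters at which the curves meet can be required to satisfy any eventual condition
  have meet : ∀ p : ℝ → Prop, (∀ᶠ t in 𝓝 0, p t) →
      ∃ t s, 0 < t ∧ 0 < s ∧ p t ∧ p s ∧ f t = g s := by
    intro p hp
    obtain ⟨ε, hε, h⟩ := Metric.eventually_nhds_iff.1 hp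
    obtain ⟨t, ht, s, hs, hts⟩ := hfreq ε hε
    refine ⟨t, s, ht.1, hs.1, h ?_, h ?_, hts⟩
    · rw [Real.dist_eq, sub_zero, abs_of_pos ht.1]; exact ht.2
    · rw [Real.dist_eq, sub_zero, abs_of_pos hs.1]; exact hs.2
  obtain ⟨k, σ, A, A', hk, hσ, hA, hA', hA0, hA'0, haA, hA'A, -, hApos, -⟩ :=
    exists_analytic_coordinate hla (by simp) hl
  have hlne : ¬ ∀ᶠ s in 𝓝 0, l (g s - f 0) = 0 := by
    intro hz
    obtain ⟨t, s, ht, -, ⟨h1, h2, -⟩, ⟨-, -, h3⟩, hts⟩ := meet _ (haA.and (hApos.and hz))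
    rw [← hts, h1] at h3
    refine mul_ne_zero ?_ (pow_ne_zero k (h2 ht).ne') h3
    rcases hσ with rfl | rfl <;> norm_num
  obtain ⟨m, τ, B, B', hm, hτ, hB, hB', hB0, hB'0, hbB, hB'B, -, hBpos, hB'pos⟩ :=
    exists_analytic_coordinate hlb (by simp [h0]) hlne
  have hστ : ∀ {u v : ℝ}, 0 < u → 0 < v → σ * u = τ * v → u = v := by
    intro u v hu hv huv
    rcases hσ with rfl | rfl <;> rcases hτ with rfl | rfl <;> linarith
  have hpowk : Tendsto (fun w : ℝ => w ^ k) (𝓝 0) (𝓝 0) := by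
    simpa [hk] using (continuous_pow (M := ℝ) k).tendsto 0
  have hF : AnalyticAt ℝ (fun w : ℝ => f (A' (w ^ m))) 0 := by
    refine AnalyticAt.fun_comp (by simpa [hm, hA'0] using hf) ?_
    exact AnalyticAt.fun_comp (by simpa [hm] using hA') (analyticAt_id.pow m)
  have hG : AnalyticAt ℝ (fun w : ℝ => g (B' (w ^ k))) 0 := by
    refine AnalyticAt.fun_comp (by simpa [hk, hB'0] using hg) ?_
    exact AnalyticAt.fun_comp (by simpa [hk] using hB') (analyticAt_id.pow k)
  have hroot : Tendsto (fun t => A t ^ ((m : ℝ)⁻¹)) (𝓝 0) (𝓝 0) := by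
    have : ContinuousAt (fun t => A t ^ ((m : ℝ)⁻¹)) 0 :=
      hA.continuousAt.rpow_const (.inr (by positivity))
    simpa [ContinuousAt, hA0, Real.zero_rpow (inv_ne_zero (Nat.cast_ne_zero.2 hm))] using this
  have hFG : ∀ᶠ w in 𝓝 0, f (A' (w ^ m)) = g (B' (w ^ k)) := by
    rw [← hF.frequently_eq_iff_eventually_eq hG]
    intro hcon
    obtain ⟨t, s, ht, hs, h1, h2, hts⟩ := meet _
      ((hroot.eventually (eventually_nhdsWithin_iff.1 hcon)).and
        (haA.and (hA'A.and (hApos.and (hbB.and (hB'B.and hBpos))))))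
    have hAt := h1.2.2.2.1 ht
    have hBs := h2.2.2.2.2.2.2 hs
    have hwm : (A t ^ ((m : ℝ)⁻¹)) ^ m = A t := Real.rpow_inv_natCast_pow hAt.le hm
    have hw : 0 < A t ^ ((m : ℝ)⁻¹) := Real.rpow_pos_of_pos hAt _
    refine h1.1 (by simpa using hw.ne') ?_
    have e1 : A t ^ k = B s ^ m := by
      refine hστ (by positivity) (by positivity) ?_
      rw [← h1.2.1, ← h2.2.2.2.2.1, hts]
    have e2 : (A t ^ ((m : ℝ)⁻¹)) ^ k = B s := by
      refine (pow_left_inj₀ (by positivity) hBs.le hm).1 ?_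
      rw [← pow_mul, mul_comm, pow_mul, hwm, e1]
    beta_reduce
    rw [hwm, e2, h1.2.2.1, h2.2.2.2.2.2.1, hts]
  have hB't : Tendsto (fun t => B' ((A t ^ ((m : ℝ)⁻¹)) ^ k)) (𝓝 0) (𝓝 0) := by
    have : Tendsto B' (𝓝 0) (𝓝 0) := by simpa only [hB'0] using hB'.continuousAt.tendsto
    exact this.comp (hpowk.comp hroot)
  obtain ⟨ε, hε, h⟩ := Metric.eventually_nhds_iff.1 ((hroot.eventually hFG).and (hA'A.and
    (hApos.and ((hB't.eventually (gt_mem_nhds hη)).and ((hpowk.comp hroot).eventually hB'pos)))))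
  refine ⟨ε, hε, fun t ht => ?_⟩
  obtain ⟨h1, h2, h3, h4, h5⟩ := h (y := t) (by
    rw [Real.dist_eq, sub_zero, abs_of_pos ht.1]; exact ht.2)
  have hAt := h3 ht.1
  refine ⟨_, ⟨h5 (pow_pos (Real.rpow_pos_of_pos hAt _) _), h4⟩, ?_⟩
  change f t = g (B' ((A t ^ ((m : ℝ)⁻¹)) ^ k))
  rw [← h1, Real.rpow_inv_natCast_pow hAt.le hm, h2]

/-! ### Subdivisions of intervals -/

/-- A property of intervals that passes to subintervals and holds near every point on either side
holds on the pieces of a finite subdivision. -/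
theorem exists_subdivision {Good : ℝ → ℝ → Prop} {a b : ℝ} (hab : a ≤ b)
    (hmono : ∀ {c d c' d'}, c ≤ c' → d' ≤ d → Good c d → Good c' d')
    (hr : ∀ t ∈ Ico a b, ∃ d, t < d ∧ Good t d) (hl : ∀ t ∈ Ioc a b, ∃ c, c < t ∧ Good c t) :
    ∃ F : Finset ℝ, a ∈ F ∧ b ∈ F ∧ (∀ x ∈ F, x ∈ Icc a b) ∧
      ∀ c d, a ≤ c → c < d → d ≤ b → (∀ x ∈ F, x ∉ Ioo c d) → Good c d := by
  have hr' : ∀ t : ℝ, ∃ d, t < d ∧ (t ∈ Ico a b → Good t d) := fun t => by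
    by_cases ht : t ∈ Ico a b
    · obtain ⟨d, h1, h2⟩ := hr t ht
      exact ⟨d, h1, fun _ => h2⟩
    · exact ⟨t + 1, by linarith, fun h => absurd h ht⟩
  have hl' : ∀ t : ℝ, ∃ c, c < t ∧ (t ∈ Ioc a b → Good c t) := fun t => by
    by_cases ht : t ∈ Ioc a b
    · obtain ⟨d, h1, h2⟩ := hl t ht
      exact ⟨d, h1, fun _ => h2⟩
    · exact ⟨t - 1, by linarith, fun h => absurd h ht⟩
  choose r hr1 hr2 using hr'
  choose l hl1 hl2 using hl'
  obtain ⟨s, hs, hcov⟩ := (isCompact_Icc (a := a) (b := b)).elim_nhds_subcover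
    (fun t => Ioo (l t) (r t)) fun t _ => Ioo_mem_nhds (hl1 t) (hr1 t)
  refine ⟨{a, b} ∪ s ∪ (s.image l ∪ s.image r).filter (· ∈ Icc a b), by simp, by simp, ?_, ?_⟩
  · intro x hx
    simp only [Finset.mem_union, Finset.mem_insert, Finset.mem_singleton, Finset.mem_filter] at hx
    rcases hx with ((rfl | rfl) | hx) | hx
    exacts [⟨le_rfl, hab⟩, ⟨hab, le_rfl⟩, hs x hx, hx.2]
  · intro c d hac hcd hdb hF
    obtain ⟨t, ht, htm⟩ := mem_iUnion₂.1
      (hcov (show (c + d) / 2 ∈ Icc a b from ⟨by linarith, by linarith⟩))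
    have h1 : t ∉ Ioo c d := hF t (by simp [ht])
    rcases le_or_gt t c with htc | htc
    · refine hmono htc (not_lt.1 fun hlt => ?_) (hr2 t ⟨(hs t ht).1, by linarith⟩)
      refine hF (r t) ?_ ⟨by linarith [htm.2], hlt⟩
      simp only [Finset.mem_union, Finset.mem_filter, Finset.mem_image]
      exact .inr ⟨.inr ⟨t, ht, rfl⟩, by linarith [htm.2], by linarith⟩
    · have htd : d ≤ t := not_lt.1 fun h => h1 ⟨htc, h⟩
      refine hmono (not_lt.1 fun hlt => ?_) htd (hl2 t ⟨by linarith, (hs t ht).2⟩)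
      refine hF (l t) ?_ ⟨hlt, by linarith [htm.1]⟩
      simp only [Finset.mem_union, Finset.mem_filter, Finset.mem_image]
      exact .inr ⟨.inl ⟨t, ht, rfl⟩, by linarith, by linarith [htm.1]⟩

/-- A transitive relation that holds between consecutive points of a finite set holds between all
its points. -/
theorem rel_of_consecutive {Q : ℝ → ℝ → Prop} (htrans : ∀ {x y z}, Q x y → Q y z → Q x z)
    (F : Finset ℝ) (hF : ∀ c ∈ F, ∀ d ∈ F, c < d → (∀ x ∈ F, x ∉ Ioo c d) → Q c d) {a b : ℝ}
    (ha : a ∈ F) (hb : b ∈ F) (hab : a < b) : Q a b := by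
  induction hn : (F.filter (· ∈ Ioo a b)).card using Nat.strong_induction_on generalizing a b with
  | _ n ih =>
  by_cases h : ∀ x ∈ F, x ∉ Ioo a b
  · exact hF a ha b hb hab h
  · push Not at h
    obtain ⟨x, hx, hxab⟩ := h
    have hcard : ∀ c d, a ≤ c → d ≤ b → x ∉ Ioo c d → (F.filter (· ∈ Ioo c d)).card < n := by
      intro c d hc hd hxcd
      rw [← hn]
      refine Finset.card_lt_card ⟨fun y hy => ?_, fun hsub => ?_⟩
      · rw [Finset.mem_filter] at hy ⊢
        exact ⟨hy.1, hc.trans_lt hy.2.1, hy.2.2.trans_le hd⟩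
      · exact hxcd (Finset.mem_filter.1 (hsub (Finset.mem_filter.2 ⟨hx, hxab⟩))).2
    exact htrans (ih _ (hcard a x le_rfl hxab.2.le (by simp)) ha hx hxab.1 rfl)
      (ih _ (hcard x b hxab.1.le le_rfl (by simp)) hx hb hxab.2 rfl)

/-! ### Analytic arcs -/

section Arcs

variable {E : Type*} [NormedAddCommGroup E] [NormedSpace ℝ E]
  {M : Type*} [TopologicalSpace M] [ChartedSpace E M]

variable (E) in
/-- The curve `f` is regular at `t`: some analytic function on `M` has non-zero derivative along
`f` at `t`. -/
def IsRegularAt (f : ℝ → M) (t : ℝ) : Prop :=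
  ∃ (u : M → ℝ) (u' : ℝ), ContMDiffAt 𝓘(ℝ, E) 𝓘(ℝ, ℝ) ω u (f t) ∧
    HasDerivAt (fun s => u (f s)) u' t ∧ u' ≠ 0

variable (E) in
/-- The curve `f` restricts to an analytic arc on `[a, b]`: it is analytic up to the end points,
injective, and regular in the interior. It may fail to be regular at the end points. -/
structure IsArc (f : ℝ → M) (a b : ℝ) : Prop where
  lt : a < b
  analytic : ContMDiffOn 𝓘(ℝ, ℝ) 𝓘(ℝ, E) ω f (Icc a b)
  injOn : InjOn f (Icc a b)
  regular : ∀ t ∈ Ioo a b, IsRegularAt E f t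

variable (E) in
/-- The curve `f` is analytic on `[a, b]`, and it is constant there or injective and regular. -/
def IsPiece (f : ℝ → M) (a b : ℝ) : Prop :=
  ContMDiffOn 𝓘(ℝ, ℝ) 𝓘(ℝ, E) ω f (Icc a b) ∧
    ((∀ t ∈ Icc a b, f t = f a) ∨ InjOn f (Icc a b) ∧ ∀ t ∈ Ioo a b, IsRegularAt E f t)

theorem IsArc.mono {f : ℝ → M} {a b c d : ℝ} (h : IsArc E f a b) (hac : a ≤ c) (hcd : c < d)
    (hdb : d ≤ b) : IsArc E f c d :=
  ⟨hcd, h.analytic.mono (Icc_subset_Icc hac hdb), h.injOn.mono (Icc_subset_Icc hac hdb),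
    fun t ht => h.regular t (Ioo_subset_Ioo hac hdb ht)⟩

theorem IsPiece.mono {f : ℝ → M} {a b c d : ℝ} (h : IsPiece E f a b) (hac : a ≤ c)
    (hdb : d ≤ b) : IsPiece E f c d := by
  have hsub := Icc_subset_Icc hac hdb
  refine ⟨h.1.mono hsub, h.2.imp (fun hc t ht => ?_) fun hi =>
    ⟨hi.1.mono hsub, fun t ht => hi.2 t (Ioo_subset_Ioo hac hdb ht)⟩⟩
  rw [hc t (hsub ht), hc c (hsub ⟨le_rfl, ht.1.trans ht.2⟩)]

theorem IsRegularAt.comp_affine {f : ℝ → M} {p q t : ℝ} (hp : p ≠ 0)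
    (h : IsRegularAt E f (p * t + q)) : IsRegularAt E (fun s => f (p * s + q)) t := by
  obtain ⟨u, u', hu, hd, hne⟩ := h
  have haff : HasDerivAt (fun s : ℝ => p * s + q) p t := by
    simpa using ((hasDerivAt_id t).const_mul p).add_const q
  exact ⟨u, u' * p, hu, HasDerivAt.comp (h₂ := fun s => u (f s)) t hd haff, mul_ne_zero hne hp⟩

theorem IsPiece.comp_affine {f : ℝ → M} {a b c d p q : ℝ} (hp : p ≠ 0) (h : IsPiece E f c d)
    (hI : ∀ t ∈ Icc a b, p * t + q ∈ Icc c d) (hI' : ∀ t ∈ Ioo a b, p * t + q ∈ Ioo c d) :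
    IsPiece E (fun s => f (p * s + q)) a b := by
  refine ⟨contMDiffOn_affine_comp h.1 hI fun _ _ => rfl, h.2.imp (fun hc t ht => ?_) fun hi =>
    ⟨fun s hs t ht hst => ?_, fun t ht => (hi.2 _ (hI' t ht)).comp_affine hp⟩⟩
  · change f _ = f _
    rw [hc _ (hI t ht), hc _ (hI a ⟨le_rfl, ht.1.trans ht.2⟩)]
  · have := hi.1 (hI s hs) (hI t ht) hst
    exact mul_left_cancel₀ hp (add_right_cancel this)

variable [IsManifold 𝓘(ℝ, E) ω M]

/-- Near an end point an analytic curve is, in a chart, the restriction of an analytic germ. -/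
theorem exists_analytic_germ [CompleteSpace E] {f : ℝ → M} {δ : ℝ} (hδ : 0 < δ)
    (hf : ContMDiffOn 𝓘(ℝ, ℝ) 𝓘(ℝ, E) ω f (Icc 0 δ)) :
    ∃ F : ℝ → E, AnalyticAt ℝ F 0 ∧ ∃ η, 0 < η ∧ η ≤ δ ∧ ∀ t ∈ Icc 0 η,
      f t ∈ (chartAt E (f 0)).source ∧ extChartAt 𝓘(ℝ, E) (f 0) (f t) = F t := by
  have h0 := hf 0 ⟨le_rfl, hδ.le⟩
  have h1 := (contMDiffWithinAt_iff.1 h0).2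
  have h2 : AnalyticWithinAt ℝ (fun t => extChartAt 𝓘(ℝ, E) (f 0) (f t)) (Icc 0 δ) 0 := by
    have := h1.analyticWithinAt
    simpa [Function.comp_def, chartAt_self_eq] using this
  obtain ⟨F, hF, hFa⟩ := analyticWithinAt_iff_exists_analyticAt.1 h2
  rw [insert_eq_of_mem (show (0 : ℝ) ∈ Icc 0 δ from ⟨le_rfl, hδ.le⟩), nhdsWithin_Icc_eq_nhdsGE hδ]
    at hF
  have hs : ∀ᶠ t in 𝓝[≥] (0 : ℝ), f t ∈ (chartAt E (f 0)).source := by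
    rw [← nhdsWithin_Icc_eq_nhdsGE hδ]
    exact h0.continuousWithinAt (chart_source_mem_nhds E (f 0))
  obtain ⟨u, hu, hus⟩ := mem_nhdsGE_iff_exists_Icc_subset.1 (hs.and hF)
  have hu' : (0 : ℝ) < u := hu
  exact ⟨F, hFa, min u δ, lt_min hu' hδ, min_le_right _ _, fun t ht =>
    hus ⟨ht.1, ht.2.trans (min_le_left _ _)⟩⟩

/-- A non-constant analytic function germ has non-vanishing derivative off the base point. -/
theorem eventually_deriv_ne_zero {v : ℝ → ℝ} (hv : AnalyticAt ℝ v 0)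
    (hne : ¬ ∀ᶠ t in 𝓝 0, v t = v 0) : ∀ᶠ t in 𝓝[≠] 0, deriv v t ≠ 0 := by
  refine hv.deriv.eventually_eq_zero_or_eventually_ne_zero.resolve_left fun hz => hne ?_
  obtain ⟨ε, hε, h⟩ := Metric.eventually_nhds_iff_ball.1 (hz.and hv.eventually_analyticAt)
  filter_upwards [Metric.ball_mem_nhds 0 hε] with t ht
  exact Metric.isOpen_ball.is_const_of_deriv_eq_zero (convex_ball _ _).isPreconnected
    (fun s hs => (h s hs).2.differentiableAt.differentiableWithinAt) (fun s hs => (h s hs).1)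
    ht (Metric.mem_ball_self hε)

theorem exists_isPiece_zero [CompleteSpace E] {f : ℝ → M} {δ : ℝ} (hδ : 0 < δ)
    (hf : ContMDiffOn 𝓘(ℝ, ℝ) 𝓘(ℝ, E) ω f (Icc 0 δ)) : ∃ η, 0 < η ∧ IsPiece E f 0 η := by
  obtain ⟨F, hF, η, hη, hηδ, h⟩ := exists_analytic_germ hδ hf
  have hF0 := (h 0 ⟨le_rfl, hη.le⟩).2
  by_cases hc : ∀ᶠ t in 𝓝 0, F t = F 0
  · obtain ⟨ε, hε, hball⟩ := Metric.eventually_nhds_iff.1 hc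
    refine ⟨min η (ε / 2), lt_min hη (half_pos hε),
      hf.mono (Icc_subset_Icc_right ((min_le_left _ _).trans hηδ)), .inl fun t ht => ?_⟩
    have htη : t ∈ Icc 0 η := ⟨ht.1, ht.2.trans (min_le_left _ _)⟩
    have : F t = F 0 := hball (by
      rw [Real.dist_eq, sub_zero, abs_of_nonneg ht.1]
      linarith [ht.2.trans (min_le_right _ _)])
    rw [← (h t htη).2, ← hF0] at this
    exact (extChartAt 𝓘(ℝ, E) (f 0)).injOn (by simpa using (h t htη).1) (by simp) this
  · obtain ⟨l, hl⟩ := exists_functional_not_eventually_zero hF hc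
    have hv : AnalyticAt ℝ (fun t => l (F t)) 0 := (l.analyticAt _).comp hF
    have hd := eventually_deriv_ne_zero hv (by simpa [sub_eq_zero] using hl)
    obtain ⟨ε, hε, hball⟩ := Metric.eventually_nhds_iff.1
      ((eventually_nhdsWithin_iff.1 hd).and hv.eventually_analyticAt)
    have hball' : ∀ t, 0 ≤ t → t < ε → (t ≠ 0 → deriv (fun t => l (F t)) t ≠ 0) ∧
        AnalyticAt ℝ (fun t => l (F t)) t := fun t ht htε =>
      hball (by rwa [Real.dist_eq, sub_zero, abs_of_nonneg ht])
    have hle : min η (ε / 2) < ε := (min_le_right _ _).trans_lt (half_lt_self hε)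
    have rolle : ∀ s t, 0 ≤ s → s < t → t ≤ min η (ε / 2) → l (F s) ≠ l (F t) := by
      intro s t hs hst ht heq
      obtain ⟨x, hx, hx0⟩ := exists_deriv_eq_zero (f := fun t => l (F t)) hst
        (fun x hx => (hball' x (hs.trans hx.1)
          (by linarith [hx.2])).2.continuousAt.continuousWithinAt) heq
      exact (hball' x (by linarith [hx.1]) (by linarith [hx.2])).1 (by linarith [hx.1]) hx0
    refine ⟨min η (ε / 2), lt_min hη (half_pos hε),
      hf.mono (Icc_subset_Icc_right ((min_le_left _ _).trans hηδ)), .inr ⟨?_, fun t ht => ?_⟩⟩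
    · intro s hs t ht hst
      have e : l (F s) = l (F t) := by
        rw [← (h s ⟨hs.1, hs.2.trans (min_le_left _ _)⟩).2,
          ← (h t ⟨ht.1, ht.2.trans (min_le_left _ _)⟩).2, hst]
      rcases lt_trichotomy s t with hlt | heq | hgt
      · exact absurd e (rolle s t hs.1 hlt ht.2)
      · exact heq
      · exact absurd e.symm (rolle t s ht.1 hgt hs.2)
    · have htη : t ∈ Ioo 0 η := ⟨ht.1, ht.2.trans_le (min_le_left _ _)⟩
      obtain ⟨h1, h2⟩ := hball' t ht.1.le (ht.2.trans hle)
      refine ⟨fun x => l (extChartAt 𝓘(ℝ, E) (f 0) x), _, ?_, ?_, h1 ht.1.ne'⟩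
      · have hψ : ContMDiffAt 𝓘(ℝ, E) 𝓘(ℝ, E) ω (extChartAt 𝓘(ℝ, E) (f 0)) (f t) :=
          contMDiffAt_extChartAt' (h t (Ioo_subset_Icc_self htη)).1
        exact l.contDiff.contMDiff.contMDiffAt.comp _ hψ
      · refine h2.differentiableAt.hasDerivAt.congr_of_eventuallyEq ?_
        filter_upwards [Ioo_mem_nhds htη.1 htη.2] with s hs
        rw [(h s (Ioo_subset_Icc_self hs)).2]

theorem exists_isPiece_right [CompleteSpace E] {f : ℝ → M} {a b : ℝ} (hab : a < b)
    (hf : ContMDiffOn 𝓘(ℝ, ℝ) 𝓘(ℝ, E) ω f (Icc a b)) : ∃ d, a < d ∧ IsPiece E f a d := by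
  obtain ⟨η, hη, h⟩ := exists_isPiece_zero (f := fun t => f (1 * t + a)) (sub_pos.2 hab)
    (contMDiffOn_affine_comp hf (fun t ht => ⟨by linarith [ht.1], by linarith [ht.2]⟩)
      fun _ _ => rfl)
  refine ⟨a + η, by linarith, ?_⟩
  have := h.comp_affine (a := a) (b := a + η) one_ne_zero (q := -a)
    (fun t ht => ⟨by linarith [ht.1], by linarith [ht.2]⟩)
    (fun t ht => ⟨by linarith [ht.1], by linarith [ht.2]⟩)
  simpa using this

theorem exists_isPiece_left [CompleteSpace E] {f : ℝ → M} {a b : ℝ} (hab : a < b)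
    (hf : ContMDiffOn 𝓘(ℝ, ℝ) 𝓘(ℝ, E) ω f (Icc a b)) : ∃ c, c < b ∧ IsPiece E f c b := by
  obtain ⟨η, hη, h⟩ := exists_isPiece_zero (f := fun t => f (-1 * t + b)) (sub_pos.2 hab)
    (contMDiffOn_affine_comp hf (fun t ht => ⟨by linarith [ht.2], by linarith [ht.1]⟩)
      fun _ _ => rfl)
  refine ⟨b - η, by linarith, ?_⟩
  have := h.comp_affine (a := b - η) (b := b) (p := -1) (by norm_num) (q := b)
    (fun t ht => ⟨by linarith [ht.2], by linarith [ht.1]⟩)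
    (fun t ht => ⟨by linarith [ht.2], by linarith [ht.1]⟩)
  simpa using this

/-- A piecewise analytic path has a finite subdivision into constant pieces and arcs. -/
theorem IsPiecewiseAnalytic.exists_pieces [CompleteSpace E] {x y : M} {γ : Path x y}
    (h : IsPiecewiseAnalytic E γ) : ∃ F : Finset ℝ, 0 ∈ F ∧ 1 ∈ F ∧ (∀ t ∈ F, t ∈ Icc 0 1) ∧
      ∀ c d : ℝ, 0 ≤ c → c < d → d ≤ 1 → (∀ t ∈ F, t ∉ Ioo c d) → IsPiece E γ.extend c d := by
  obtain ⟨F, hF⟩ := h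
  have hcl : ∀ t : ℝ, ((F.erase t : Finset ℝ) : Set ℝ)ᶜ ∈ 𝓝 t := fun t =>
    (F.erase t).finite_toSet.isClosed.isOpen_compl.mem_nhds (by simp)
  refine exists_subdivision zero_le_one (fun h1 h2 h => h.mono h1 h2) (fun t ht => ?_)
    fun t ht => ?_
  · obtain ⟨u, hu, hus⟩ := mem_nhdsGE_iff_exists_Icc_subset.1
      (nhdsWithin_le_nhds (s := Ici t) (hcl t))
    have hu' : t < u := hu
    refine exists_isPiece_right (lt_min hu' ht.2)
      (hF t (min u 1) ht.1 (min_le_right _ _) fun s hs hsI => ?_)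
    exact hus ⟨hsI.1.le, hsI.2.le.trans (min_le_left _ _)⟩
      (Finset.mem_coe.2 (Finset.mem_erase.2 ⟨hsI.1.ne', hs⟩))
  · obtain ⟨u, hu, hus⟩ := mem_nhdsLE_iff_exists_Icc_subset.1
      (nhdsWithin_le_nhds (s := Iic t) (hcl t))
    have hu' : u < t := hu
    refine exists_isPiece_left (max_lt hu' ht.1)
      (hF (max u 0) t (le_max_right _ _) ht.2 fun s hs hsI => ?_)
    exact hus ⟨(le_max_left _ _).trans hsI.1.le, hsI.2.le⟩
      (Finset.mem_coe.2 (Finset.mem_erase.2 ⟨hsI.2.ne, hs⟩))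

end Arcs

/-! ### Intersections of analytic arcs -/

section Intersections

variable {E : Type*} [NormedAddCommGroup E] [NormedSpace ℝ E] [CompleteSpace E]
  {M : Type*} [TopologicalSpace M] [ChartedSpace E M] [IsManifold 𝓘(ℝ, E) ω M]

/-- `analytic_germ_subset` for curves in a manifold. -/
theorem germ_subset {f g : ℝ → M} {δ δ' : ℝ} (hδ : 0 < δ) (hδ' : 0 < δ')
    (hf : ContMDiffOn 𝓘(ℝ, ℝ) 𝓘(ℝ, E) ω f (Icc 0 δ)) (hfi : InjOn f (Icc 0 δ))
    (hg : ContMDiffOn 𝓘(ℝ, ℝ) 𝓘(ℝ, E) ω g (Icc 0 δ')) (h0 : f 0 = g 0)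
    (hfreq : ∀ ε > 0, ∃ t ∈ Ioo 0 ε, ∃ s ∈ Ioo 0 ε, f t = g s) :
    ∃ ε > 0, ∀ t ∈ Ioo 0 ε, f t ∈ g '' Icc 0 δ' := by
  obtain ⟨F, hF, η, hη, hηδ, hfF⟩ := exists_analytic_germ hδ hf
  obtain ⟨G, hG, θ, hθ, hθδ, hgG⟩ := exists_analytic_germ hδ' hg
  rw [← h0] at hgG
  have hinj : InjOn (extChartAt 𝓘(ℝ, E) (f 0)) (chartAt E (f 0)).source := by
    simpa using (extChartAt 𝓘(ℝ, E) (f 0)).injOn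
  have hF0 := hfF 0 ⟨le_rfl, hη.le⟩
  have hG0 := hgG 0 ⟨le_rfl, hθ.le⟩
  obtain ⟨ε, hε, h⟩ := analytic_germ_subset hF hG (by rw [← hF0.2, ← hG0.2, h0])
    (fun hc => by
      obtain ⟨ε, hε, hball⟩ := Metric.eventually_nhds_iff.1 hc
      have hm : 0 < min η (ε / 2) := lt_min hη (half_pos hε)
      have hmη : min η (ε / 2) ∈ Icc 0 η := ⟨hm.le, min_le_left _ _⟩
      have : F (min η (ε / 2)) = F 0 := hball (by
        rw [Real.dist_eq, sub_zero, abs_of_pos hm]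
        linarith [min_le_right η (ε / 2)])
      rw [← (hfF _ hmη).2, ← hF0.2] at this
      exact hm.ne' (hfi ⟨hm.le, hmη.2.trans hηδ⟩ ⟨le_rfl, hδ.le⟩
        (hinj (hfF _ hmη).1 hF0.1 this)))
    (fun ε hε => by
      obtain ⟨t, ht, s, hs, hts⟩ := hfreq (min ε (min η θ)) (lt_min hε (lt_min hη hθ))
      simp only [mem_Ioo, lt_min_iff] at ht hs
      refine ⟨t, ⟨ht.1, ht.2.1⟩, s, ⟨hs.1, hs.2.1⟩, ?_⟩
      rw [← (hfF t ⟨ht.1.le, ht.2.2.1.le⟩).2, ← (hgG s ⟨hs.1.le, hs.2.2.2.le⟩).2, hts]) hθ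
  refine ⟨min ε η, lt_min hε hη, fun t ht => ?_⟩
  simp only [mem_Ioo, lt_min_iff] at ht
  obtain ⟨s, hs, hts⟩ := h t ⟨ht.1, ht.2.1⟩
  have e1 := hfF t ⟨ht.1.le, ht.2.2.le⟩
  have e2 := hgG s (Ioo_subset_Icc_self hs)
  exact ⟨s, ⟨hs.1.le, hs.2.le.trans hθδ⟩, hinj e2.1 e1.1 (by rw [e2.2, e1.2, hts])⟩

variable [T2Space M]

/-- At its initial point an analytic curve either leaves a given arc or stays in it for some
time. -/
theorem exists_trace_zero {f g : ℝ → M} {δ c d : ℝ} (hδ : 0 < δ)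
    (hf : ContMDiffOn 𝓘(ℝ, ℝ) 𝓘(ℝ, E) ω f (Icc 0 δ)) (hfi : InjOn f (Icc 0 δ))
    (hg : ContMDiffOn 𝓘(ℝ, ℝ) 𝓘(ℝ, E) ω g (Icc c d)) :
    ∃ η > 0, (∀ t ∈ Ioo 0 η, f t ∈ g '' Icc c d) ∨ ∀ t ∈ Ioo 0 η, f t ∉ g '' Icc c d := by
  by_cases hfreq : ∀ ε > 0, ∃ t ∈ Ioo 0 ε, ∃ s ∈ Icc c d, g s = f t
  swap
  · push Not at hfreq
    obtain ⟨ε, hε, h⟩ := hfreq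
    exact ⟨ε, hε, .inr fun t ht ⟨s, hs, hst⟩ => h t ht s hs hst⟩
  have hpos : ∀ n : ℕ, 0 < δ / ((n : ℝ) + 1) := fun n => by positivity
  choose t ht s hs hst using fun n : ℕ => hfreq _ (hpos n)
  have ht0 : Tendsto t atTop (𝓝 0) := by
    refine squeeze_zero (fun n => (ht n).1.le) (fun n => (ht n).2.le) ?_
    simpa [div_eq_mul_inv] using (tendsto_one_div_add_atTop_nhds_zero_nat (𝕜 := ℝ)).const_mul δ
  have htδ : ∀ n, t n ∈ Icc 0 δ := fun n => ⟨(ht n).1.le, (ht n).2.le.trans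
    (div_le_self hδ.le (by linarith [n.cast_nonneg (α := ℝ)]))⟩
  obtain ⟨s₀, hs₀, φ, hφ, hlim⟩ := isCompact_Icc.tendsto_subseq hs
  have hft : Tendsto (fun n => f (t (φ n))) atTop (𝓝 (f 0)) :=
    (hf.continuousOn 0 ⟨le_rfl, hδ.le⟩).tendsto.comp (tendsto_nhdsWithin_iff.2
      ⟨ht0.comp hφ.tendsto_atTop, .of_forall fun n => htδ _⟩)
  have hgs : Tendsto (fun n => g (s (φ n))) atTop (𝓝 (g s₀)) :=
    (hg.continuousOn s₀ hs₀).tendsto.comp (tendsto_nhdsWithin_iff.2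
      ⟨hlim, .of_forall fun n => hs _⟩)
  simp only [hst] at hgs
  have h0 : f 0 = g s₀ := tendsto_nhds_unique hft hgs
  have hne : ∀ n, s (φ n) ≠ s₀ := fun n he => by
    have := hst (φ n)
    rw [he, ← h0] at this
    exact (ht (φ n)).1.ne (hfi ⟨le_rfl, hδ.le⟩ (htδ _) this)
  -- the sign `p` says on which side of `s₀` the parameters accumulate
  have key : ∀ p : ℝ, p * p = 1 → (∃ᶠ n in atTop, 0 < p * (s (φ n) - s₀)) →
      ∃ η > 0, ∀ t ∈ Ioo 0 η, f t ∈ g '' Icc c d := by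
    intro p hp hfr
    obtain ⟨n₀, hn₀⟩ := hfr.exists
    have hI : ∀ τ ∈ Icc 0 (p * (s (φ n₀) - s₀)), p * τ + s₀ ∈ Icc c d := by
      intro τ hτ
      have h1 := hs (φ n₀)
      have e : p * (p * (s (φ n₀) - s₀)) = s (φ n₀) - s₀ := by rw [← mul_assoc, hp, one_mul]
      rcases le_total 0 p with h | h
      · have := mul_le_mul_of_nonneg_left hτ.2 h
        have := mul_nonneg h hτ.1
        exact ⟨by linarith [hs₀.1], by linarith [h1.2]⟩
      · have := mul_le_mul_of_nonpos_left hτ.2 h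
        have := mul_nonpos_of_nonpos_of_nonneg h hτ.1
        exact ⟨by linarith [h1.1], by linarith [hs₀.2]⟩
    obtain ⟨η, hη, h⟩ := germ_subset (g := fun τ => g (p * τ + s₀)) hδ hn₀ hf hfi
      (contMDiffOn_affine_comp hg hI fun _ _ => rfl) (by simpa using h0) (fun ε hε => by
        have e1 : ∀ᶠ n in atTop, t (φ n) < ε :=
          (ht0.comp hφ.tendsto_atTop).eventually (gt_mem_nhds hε)
        have e2 : ∀ᶠ n in atTop, p * (s (φ n) - s₀) < ε := by
          have : Tendsto (fun n => p * (s (φ n) - s₀)) atTop (𝓝 0) := by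
            simpa using (hlim.sub_const s₀).const_mul p
          exact this.eventually (gt_mem_nhds hε)
        obtain ⟨n, h1, h2, h3⟩ := (hfr.and_eventually (e1.and e2)).exists
        refine ⟨_, ⟨(ht (φ n)).1, h2⟩, _, ⟨h1, h3⟩, ?_⟩
        rw [← hst, ← mul_assoc, hp, one_mul, sub_add_cancel])
    refine ⟨η, hη, fun t ht => ?_⟩
    obtain ⟨τ, hτ, e⟩ := h t ht
    exact ⟨_, hI τ hτ, e⟩
  have hfr : ∃ᶠ n in atTop, (0 < 1 * (s (φ n) - s₀) ∨ 0 < -1 * (s (φ n) - s₀)) := by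
    refine Eventually.frequently (.of_forall fun n => ?_)
    rcases lt_or_gt_of_ne (hne n) with h | h
    · right; linarith
    · left; linarith
  rcases frequently_or_distrib.1 hfr with h | h
  · obtain ⟨η, hη, h⟩ := key 1 (by norm_num) h
    exact ⟨η, hη, .inl h⟩
  · obtain ⟨η, hη, h⟩ := key (-1) (by norm_num) h
    exact ⟨η, hη, .inl h⟩

/-- An arc has a finite subdivision into pieces whose interiors are contained in a second given arc
or disjoint from it. -/
theorem exists_subdivision_trace {f g : ℝ → M} {a b c d : ℝ} (hf : IsArc E f a b)
    (hg : IsArc E g c d) : ∃ F : Finset ℝ, a ∈ F ∧ b ∈ F ∧ (∀ x ∈ F, x ∈ Icc a b) ∧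
      ∀ x y, a ≤ x → x < y → y ≤ b → (∀ z ∈ F, z ∉ Ioo x y) →
        (∀ t ∈ Ioo x y, f t ∈ g '' Icc c d) ∨ ∀ t ∈ Ioo x y, f t ∉ g '' Icc c d := by
  refine exists_subdivision hf.lt.le (fun h1 h2 h => h.imp
    (fun h t ht => h t (Ioo_subset_Ioo h1 h2 ht)) fun h t ht => h t (Ioo_subset_Ioo h1 h2 ht))
    (fun t ht => ?_) fun t ht => ?_
  · have hI : ∀ s ∈ Icc 0 (b - t), 1 * s + t ∈ Icc a b := fun s hs =>
      ⟨by linarith [ht.1, hs.1], by linarith [hs.2]⟩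
    obtain ⟨η, hη, h⟩ := exists_trace_zero (f := fun s => f (1 * s + t)) (sub_pos.2 ht.2)
      (contMDiffOn_affine_comp hf.analytic hI fun _ _ => rfl)
      (fun s hs s' hs' e => by linarith [hf.injOn (hI s hs) (hI s' hs') e]) hg.analytic
    refine ⟨t + η, by linarith, h.imp (fun h s hs => ?_) fun h s hs => ?_⟩ <;>
    · have := h (s - t) ⟨by linarith [hs.1], by linarith [hs.2]⟩
      rwa [one_mul, sub_add_cancel] at this
  · have hI : ∀ s ∈ Icc 0 (t - a), -1 * s + t ∈ Icc a b := fun s hs =>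
      ⟨by linarith [hs.2], by linarith [ht.2, hs.1]⟩
    obtain ⟨η, hη, h⟩ := exists_trace_zero (f := fun s => f (-1 * s + t)) (sub_pos.2 ht.1)
      (contMDiffOn_affine_comp hf.analytic hI fun _ _ => rfl)
      (fun s hs s' hs' e => by linarith [hf.injOn (hI s hs) (hI s' hs') e]) hg.analytic
    refine ⟨t - η, by linarith, h.imp (fun h s hs => ?_) fun h s hs => ?_⟩ <;>
    · have := h (t - s) ⟨by linarith [hs.2], by linarith [hs.1]⟩
      rwa [show -1 * (t - s) + t = s by ring] at this

/-- A family of arcs, each given as a curve with the end points of its parameter interval. -/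
abbrev ArcFamily (M : Type*) := Set ((ℝ → M) × ℝ × ℝ)

/-- An arc without its end points. -/
def interiorOf (e : (ℝ → M) × ℝ × ℝ) : Set M := e.1 '' Ioo e.2.1 e.2.2

/-- A finite family of arcs has a finite set of vertices, containing the end points of the arcs,
such that any two pieces into which the vertices divide the arcs have the same interior or disjoint
interiors. -/
theorem exists_vertices {T : ArcFamily M} (hT : T.Finite)
    (harc : ∀ e ∈ T, IsArc E e.1 e.2.1 e.2.2) (x₀ : M) :
    ∃ P : Set M, P.Finite ∧ x₀ ∈ P ∧ (∀ e ∈ T, e.1 e.2.1 ∈ P ∧ e.1 e.2.2 ∈ P) ∧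
      ∀ e ∈ T, ∀ e' ∈ T, ∀ a b a' b' : ℝ, e.2.1 ≤ a → a < b → b ≤ e.2.2 →
        e'.2.1 ≤ a' → a' < b' → b' ≤ e'.2.2 → e'.1 a' ∈ P → e'.1 b' ∈ P →
        (∀ t ∈ Ioo a b, e.1 t ∉ P) → (∀ t ∈ Ioo a' b', e'.1 t ∉ P) →
        (e.1 '' Ioo a b ∩ e'.1 '' Ioo a' b').Nonempty → e.1 '' Ioo a b ⊆ e'.1 '' Ioo a' b' := by
  have hF : ∀ e e' : (ℝ → M) × ℝ × ℝ, ∃ F : Finset ℝ, e ∈ T → e' ∈ T →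
      e.2.1 ∈ F ∧ e.2.2 ∈ F ∧ ∀ x y, e.2.1 ≤ x → x < y → y ≤ e.2.2 → (∀ z ∈ F, z ∉ Ioo x y) →
        (∀ t ∈ Ioo x y, e.1 t ∈ e'.1 '' Icc e'.2.1 e'.2.2) ∨
          ∀ t ∈ Ioo x y, e.1 t ∉ e'.1 '' Icc e'.2.1 e'.2.2 := by
    intro e e'
    by_cases h : e ∈ T ∧ e' ∈ T
    · obtain ⟨F, h1, h2, -, h3⟩ := exists_subdivision_trace (harc e h.1) (harc e' h.2)
      exact ⟨F, fun _ _ => ⟨h1, h2, h3⟩⟩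
    · exact ⟨∅, fun h1 h2 => absurd ⟨h1, h2⟩ h⟩
  choose F hF using hF
  have hmem : ∀ e ∈ T, ∀ e' ∈ T, ∀ t ∈ F e e',
      e.1 t ∈ insert x₀ (⋃ e ∈ T, ⋃ e' ∈ T, e.1 '' (F e e' : Set ℝ)) := fun e he e' he' t ht =>
    .inr (mem_iUnion₂.2 ⟨e, he, mem_iUnion₂.2 ⟨e', he', t, ht, rfl⟩⟩)
  refine ⟨insert x₀ (⋃ e ∈ T, ⋃ e' ∈ T, e.1 '' (F e e' : Set ℝ)), ?_, mem_insert _ _,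
    fun e he => ⟨hmem e he e he _ (hF e e he he).1, hmem e he e he _ (hF e e he he).2.1⟩, ?_⟩
  · exact (hT.biUnion fun e _ => hT.biUnion fun e' _ =>
      ((F e e').finite_toSet.image _)).insert x₀
  intro e he e' he' a b a' b' ha hab hb ha' hab' hb' hPa' hPb' hP hP' hne
  obtain ⟨x, hx, hx'⟩ := hne
  have htr := ((hF e e' he he').2.2 a b ha hab hb fun z hz hzI =>
    hP z hzI (hmem e he e' he' z hz)).resolve_right fun h => by
      obtain ⟨t, ht, rfl⟩ := hx
      exact h t ht (image_mono (Ioo_subset_Icc_self.trans (Icc_subset_Icc ha' hb')) hx')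
  -- the open arc is connected, avoids the vertices and is covered by two closed parts of the other
  have hcon : IsPreconnected (e.1 '' Ioo a b) := isPreconnected_Ioo.image _
    ((harc e he).analytic.continuousOn.mono (Ioo_subset_Icc_self.trans (Icc_subset_Icc ha hb)))
  have hcl : ∀ u v : ℝ, e'.2.1 ≤ u → v ≤ e'.2.2 → IsClosed (e'.1 '' Icc u v) := fun u v hu hv =>
    (isCompact_Icc.image_of_continuousOn
      ((harc e' he').analytic.continuousOn.mono (Icc_subset_Icc hu hv))).isClosed
  have hnP : ∀ y ∈ e.1 '' Ioo a b, y ≠ e'.1 a' ∧ y ≠ e'.1 b' := by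
    rintro _ ⟨t, ht, rfl⟩
    exact ⟨fun h => hP t ht (h ▸ hPa'), fun h => hP t ht (h ▸ hPb')⟩
  have hopen : ∀ s ∈ Icc a' b', e'.1 s ∈ e.1 '' Ioo a b → s ∈ Ioo a' b' := fun s hs hse =>
    ⟨lt_of_le_of_ne hs.1 fun h => (hnP _ hse).1 (h ▸ rfl),
      lt_of_le_of_ne hs.2 fun h => (hnP _ hse).2 (h ▸ rfl)⟩
  have hcover : e.1 '' Ioo a b ⊆ e'.1 '' Icc a' b' ∪
      (e'.1 '' Icc e'.2.1 a' ∪ e'.1 '' Icc b' e'.2.2) := by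
    rintro _ ⟨t, ht, rfl⟩
    obtain ⟨s, hs, hst⟩ := htr t ht
    rw [← hst]
    rcases le_total s a' with h | h
    · exact .inr (.inl ⟨s, ⟨hs.1, h⟩, rfl⟩)
    rcases le_total s b' with h' | h'
    · exact .inl ⟨s, ⟨h, h'⟩, rfl⟩
    · exact .inr (.inr ⟨s, ⟨h', hs.2⟩, rfl⟩)
  intro y hy
  by_contra hy'
  have hside : (e.1 '' Ioo a b ∩
      (e'.1 '' Icc e'.2.1 a' ∪ e'.1 '' Icc b' e'.2.2)).Nonempty := by
    refine ⟨y, hy, (hcover hy).resolve_left ?_⟩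
    rintro ⟨s, hs, rfl⟩
    exact hy' ⟨s, hopen s hs hy, rfl⟩
  obtain ⟨z, hz, ⟨s, hs, hsz⟩, h2⟩ := isPreconnected_closed_iff.1 hcon _ _
    (hcl a' b' ha' hb') ((hcl e'.2.1 a' le_rfl (by linarith)).union
      (hcl b' e'.2.2 (by linarith) le_rfl)) hcover
      ⟨x, hx, image_mono Ioo_subset_Icc_self hx'⟩ hside
  subst hsz
  have hs' := hopen s hs hz
  have hsI : s ∈ Icc e'.2.1 e'.2.2 := ⟨ha'.trans hs.1, hs.2.trans hb'⟩
  rcases h2 with ⟨r, hr, hrs⟩ | ⟨r, hr, hrs⟩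
  · have := (harc e' he').injOn ⟨hr.1, by linarith [hr.2]⟩ hsI hrs
    linarith [hr.2, hs'.1]
  · have := (harc e' he').injOn ⟨by linarith [hr.1], hr.2⟩ hsI hrs
    linarith [hr.1, hs'.2]

/-- A finite family of arcs can be cut into a finite family of arcs forming a graph: any two of the
pieces have the same interior, or the interior of each is disjoint from the other. -/
theorem exists_graph {T : ArcFamily M} (hT : T.Finite)
    (harc : ∀ e ∈ T, IsArc E e.1 e.2.1 e.2.2) (x₀ : M) :
    ∃ K : ArcFamily M, K.Finite ∧ (∀ e ∈ K, IsArc E e.1 e.2.1 e.2.2) ∧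
      (∀ e ∈ K, x₀ ∉ interiorOf e) ∧
      (∀ e ∈ K, ∀ e' ∈ K, interiorOf e = interiorOf e' ∨
        Disjoint (interiorOf e) (e'.1 '' Icc e'.2.1 e'.2.2)) ∧
      ∀ e ∈ T, ∃ F : Finset ℝ, e.2.1 ∈ F ∧ e.2.2 ∈ F ∧ (∀ x ∈ F, x ∈ Icc e.2.1 e.2.2) ∧
        ∀ c ∈ F, ∀ d ∈ F, c < d → (∀ x ∈ F, x ∉ Ioo c d) → (e.1, c, d) ∈ K := by
  obtain ⟨P, hP, hx₀, hend, hpiece⟩ := exists_vertices hT harc x₀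
  let V : (ℝ → M) × ℝ × ℝ → Set ℝ := fun e => Icc e.2.1 e.2.2 ∩ e.1 ⁻¹' P
  have hV : ∀ e ∈ T, (V e).Finite := fun e he =>
    Finite.of_finite_image (hP.subset (image_subset_iff.2 inter_subset_right))
      ((harc e he).injOn.mono inter_subset_left)
  let K : ArcFamily M := {k | ∃ e ∈ T, k.1 = e.1 ∧ k.2.1 ∈ V e ∧ k.2.2 ∈ V e ∧ k.2.1 < k.2.2 ∧
    ∀ t ∈ Ioo k.2.1 k.2.2, e.1 t ∉ P}
  refine ⟨K, ?_, ?_, ?_, ?_, ?_⟩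
  · refine (hT.biUnion fun e he => (finite_singleton e.1).prod ((hV e he).prod (hV e he))).subset ?_
    rintro k ⟨e, he, h1, h2, h3, -⟩
    exact mem_iUnion₂.2 ⟨e, he, h1, h2, h3⟩
  · rintro ⟨f, c, d⟩ ⟨e, he, h1, h2, h3, h4, -⟩
    dsimp only at h1 h2 h3 h4
    subst h1
    exact (harc e he).mono h2.1.1 h4 h3.1.2
  · rintro ⟨f, c, d⟩ ⟨e, he, h1, -, -, -, h5⟩ ⟨t, ht, htx⟩
    dsimp only at h1 h5 ht htx
    subst h1
    exact h5 t ht (htx ▸ hx₀)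
  · rintro ⟨f, c, d⟩ ⟨e, he, h1, h2, h3, h4, h5⟩ ⟨f', c', d'⟩ ⟨e', he', h1', h2', h3', h4', h5'⟩
    dsimp only [interiorOf] at h1 h2 h3 h4 h5 h1' h2' h3' h4' h5' ⊢
    subst h1 h1'
    by_cases hne : (e.1 '' Ioo c d ∩ e'.1 '' Ioo c' d').Nonempty
    · exact .inl (Subset.antisymm
        (hpiece e he e' he' c d c' d' h2.1.1 h4 h3.1.2 h2'.1.1 h4' h3'.1.2 h2'.2 h3'.2 h5 h5' hne)
        (hpiece e' he' e he c' d' c d h2'.1.1 h4' h3'.1.2 h2.1.1 h4 h3.1.2 h2.2 h3.2 h5' h5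
          (by rwa [inter_comm])))
    · refine .inr (disjoint_left.2 ?_)
      rintro _ ⟨t, ht, rfl⟩ ⟨s, hs, hst⟩
      rcases eq_endpoints_or_mem_Ioo_of_mem_Icc hs with rfl | rfl | hs'
      · exact h5 t ht (hst ▸ h2'.2)
      · exact h5 t ht (hst ▸ h3'.2)
      · exact hne ⟨_, ⟨t, ht, rfl⟩, s, hs', hst⟩
  · intro e he
    have hle := (harc e he).lt.le
    refine ⟨(hV e he).toFinset, ?_, ?_, fun x hx => ((hV e he).mem_toFinset.1 hx).1,
      fun c hc d hd hcd hcons => ?_⟩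
    · exact (hV e he).mem_toFinset.2 ⟨⟨le_rfl, hle⟩, (hend e he).1⟩
    · exact (hV e he).mem_toFinset.2 ⟨⟨hle, le_rfl⟩, (hend e he).2⟩
    · rw [Finite.mem_toFinset] at hc hd
      exact ⟨e, he, rfl, hc, hd, hcd, fun t ht htP => hcons t ((hV e he).mem_toFinset.2
        ⟨⟨hc.1.1.trans ht.1.le, ht.2.le.trans hd.1.2⟩, htP⟩) ht⟩

end Intersections

/-! ### Parallel transport and reparametrization -/

section Transport

variable {E : Type*} [NormedAddCommGroup E] [NormedSpace ℝ E]
  {M : Type*} [TopologicalSpace M] [ChartedSpace E M] [IsManifold 𝓘(ℝ, E) ω M]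
  {V : Type*} [NormedAddCommGroup V] [NormedSpace ℝ V] [FiniteDimensional ℝ V]
  {G : Type*} [TopologicalSpace G] [T2Space G] [ChartedSpace V G] [Group G] [LieGroup 𝓘(ℝ, V) ∞ G]

theorem HasRightLogDerivAt.comp {g : ℝ → G} {φ : ℝ → ℝ} {ξ : V} {t φ' : ℝ}
    (h : HasRightLogDerivAt g ξ (φ t)) (hφ : HasDerivAt φ φ' t) :
    HasRightLogDerivAt (fun s => g (φ s)) ((φ' • ξ : V)) t := by
  rw [hasRightLogDerivAt_iff] at h ⊢
  exact ⟨ContinuousAt.comp (f := φ) h.1 hφ.continuousAt, HasDerivAt.scomp (h := φ) t h.2 hφ⟩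

theorem SolvesOn.comp {X Y : ℝ → V} {a b c d : ℝ} {g : ℝ → G} {φ : ℝ → ℝ}
    (hg : SolvesOn X c d g) (hφ : ContinuousOn φ (Icc a b)) (hφi : InjOn φ (Icc a b))
    (hI : MapsTo φ (Icc a b) (Icc c d)) (hI' : MapsTo φ (Ioo a b) (Ioo c d))
    (h : ∀ t ∈ Ioo a b, ∃ φ', HasDerivAt φ φ' t ∧ Y t = φ' • X (φ t)) :
    SolvesOn Y a b (fun s => g (φ s)) := by
  obtain ⟨hc, F, hF⟩ := hg
  have hfin : (Icc a b ∩ φ ⁻¹' (F : Set ℝ)).Finite :=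
    Finite.of_finite_image (F.finite_toSet.subset (image_subset_iff.2 inter_subset_right))
      (hφi.mono inter_subset_left)
  refine ⟨hc.comp hφ hI, hfin.toFinset, fun t ht htF => ?_⟩
  obtain ⟨φ', hd, hY⟩ := h t ht
  rw [hY]
  exact (hF _ (hI' ht) fun hmem => htF
    (hfin.mem_toFinset.2 ⟨Ioo_subset_Icc_self ht, hmem⟩)).comp hd

theorem LieAlgebraForm.along_comp (A : LieAlgebraForm E M V G) {f γ : ℝ → M} {φ : ℝ → ℝ}
    {t φ' : ℝ} (hf : f =ᶠ[𝓝 t] fun s => γ (φ s)) (hφ : HasDerivAt φ φ' t)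
    (hγ : MDifferentiableAt 𝓘(ℝ, ℝ) 𝓘(ℝ, E) γ (φ t)) :
    A.along f t = φ' • A.along γ (φ t) := by
  have hφ' : HasMFDerivAt 𝓘(ℝ, ℝ) 𝓘(ℝ, ℝ) φ t (ContinuousLinearMap.toSpanSingleton ℝ φ') :=
    (hasDerivAt_iff_hasFDerivAt.1 hφ).hasMFDerivAt
  have h1 := ((HasMFDerivAt.comp (g := γ) t hγ.hasMFDerivAt hφ').congr_of_eventuallyEq hf).mfderiv
  let T : M → E → V := fun x w => A.toFun x w
  let D : ℝ →L[ℝ] E := mfderiv 𝓘(ℝ, ℝ) 𝓘(ℝ, E) γ (φ t)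
  have h2 : (mfderiv 𝓘(ℝ, ℝ) 𝓘(ℝ, E) f t (1 : ℝ) : E) = φ' • D 1 := by
    rw [h1]
    change D ((1 : ℝ) • φ') = φ' • D 1
    rw [← map_smul]
    congr 1
    simp
  change T (f t) (mfderiv 𝓘(ℝ, ℝ) 𝓘(ℝ, E) f t (1 : ℝ)) = φ' • T (γ (φ t)) (D 1)
  rw [h2, hf.eq_of_nhds]
  exact (A.toFun (γ (φ t))).map_smul φ' (D 1)

open Classical in
/-- The parallel transport of `A` along `f` from time `a` to time `b`, with the junk value `1` if
the transport equation has no solution. -/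
def transport (A : LieAlgebraForm E M V G) (f : ℝ → M) (a b : ℝ) : G :=
  if h : ∃ g : ℝ → G, SolvesOn (A.along f) a b g then h.choose b * (h.choose a)⁻¹ else 1

theorem transport_eq (A : LieAlgebraForm E M V G) {f : ℝ → M} {a b : ℝ} (hab : a ≤ b) {g : ℝ → G}
    (hg : SolvesOn (A.along f) a b g) : transport A f a b = g b * (g a)⁻¹ := by
  have := FiniteDimensional.complete ℝ V
  have h : ∃ g : ℝ → G, SolvesOn (A.along f) a b g := ⟨g, hg⟩
  rw [transport, dif_pos h]
  have := ((h.choose_spec.mul_right (h.choose a)⁻¹).unique (hg.mul_right (g a)⁻¹)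
    (by simp)) b ⟨hab, le_rfl⟩
  exact this

theorem holonomy_eq_transport (A : LieAlgebraForm E M V G) {x y : M} {γ : Path x y}
    (h : IsPiecewiseAnalytic E γ) : holonomy A γ h = transport A γ.extend 0 1 := by
  obtain ⟨g, -, hg⟩ := exists_transport A h
  rw [holonomy_eq A h hg, transport_eq A zero_le_one hg]

theorem transport_trans (A : LieAlgebraForm E M V G) {x y : M} {γ : Path x y}
    (h : IsPiecewiseAnalytic E γ) {a b c : ℝ} (ha : 0 ≤ a) (hab : a ≤ b) (hbc : b ≤ c)
    (hc : c ≤ 1) : transport A γ.extend a c =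
      transport A γ.extend b c * transport A γ.extend a b := by
  obtain ⟨g, -, hg⟩ := exists_transport A h
  rw [transport_eq A (hab.trans hbc) (hg.mono ha hc),
    transport_eq A hbc (hg.mono (ha.trans hab) hc), transport_eq A hab (hg.mono ha (hbc.trans hc))]
  group

theorem transport_const (A : LieAlgebraForm E M V G) {f : ℝ → M} {a b : ℝ} (hab : a ≤ b)
    (hf : ∀ t ∈ Icc a b, f t = f a) : transport A f a b = 1 := by
  have hs : SolvesOn (A.along f) a b (fun _ => (1 : G)) := by
    refine ⟨continuousOn_const, ∅, fun t ht _ => ?_⟩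
    have hev : f =ᶠ[𝓝 t] fun _ => f a := by
      filter_upwards [Icc_mem_nhds ht.1 ht.2] with s hs using hf s hs
    have h0 : A.along f t = (0 : V) := by
      have := A.along_comp (γ := fun _ => f a) (φ := fun _ => t) hev (hasDerivAt_const t t)
        mdifferentiableAt_const
      simpa using this
    rw [h0, hasRightLogDerivAt_iff]
    exact ⟨continuousAt_const, hasDerivAt_const _ _⟩
  rw [transport_eq A hab hs]
  simp

/-- An analytic curve on `[a, b]` as a path. -/
theorem exists_path_of_analytic {f : ℝ → M} {a b : ℝ} (hab : a < b)
    (hf : ContMDiffOn 𝓘(ℝ, ℝ) 𝓘(ℝ, E) ω f (Icc a b)) :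
    ∃ γ : Path (f a) (f b), IsPiecewiseAnalytic E γ ∧
      ∀ t ∈ Icc (0 : ℝ) 1, γ.extend t = f ((b - a) * t + a) := by
  have hI : ∀ t ∈ Icc (0 : ℝ) 1, (b - a) * t + a ∈ Icc a b := fun t ht =>
    ⟨by nlinarith [ht.1], by nlinarith [ht.2]⟩
  let γ : Path (f a) (f b) :=
    { toFun := fun t => f ((b - a) * t + a)
      continuous_toFun := hf.continuousOn.comp_continuous (by fun_prop) fun t => hI t t.2
      source' := by simp
      target' := by simp }
  have hγ : ∀ t ∈ Icc (0 : ℝ) 1, γ.extend t = f ((b - a) * t + a) := fun t ht => by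
    rw [Path.extend_apply _ ht]
    rfl
  refine ⟨γ, ⟨∅, fun c d hc hd _ => ?_⟩, hγ⟩
  exact contMDiffOn_affine_comp hf (fun t ht => hI t ⟨hc.trans ht.1, ht.2.trans hd⟩)
    fun t ht => hγ t ⟨hc.trans ht.1, ht.2.trans hd⟩

theorem exists_solvesOn_of_path (A : LieAlgebraForm E M V G) {x y : M} {γ : Path x y}
    (hγ : IsPiecewiseAnalytic E γ) {f : ℝ → M} {a b : ℝ} (hab : a < b)
    (h : ∀ t ∈ Icc (0 : ℝ) 1, γ.extend t = f ((b - a) * t + a)) :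
    (∃ g : ℝ → G, SolvesOn (A.along f) a b g) ∧ holonomy A γ hγ = transport A f a b := by
  obtain ⟨k, -, hk⟩ := exists_transport A hγ
  have hba : 0 < b - a := sub_pos.2 hab
  have hp : ∀ t, (b - a)⁻¹ * t + -(a * (b - a)⁻¹) = (t - a) / (b - a) := fun t => by
    field_simp
    ring
  have hI : ∀ t ∈ Icc a b, (b - a)⁻¹ * t + -(a * (b - a)⁻¹) ∈ Icc (0 : ℝ) 1 := fun t ht => by
    rw [hp]
    exact ⟨div_nonneg (by linarith [ht.1]) hba.le, (div_le_one hba).2 (by linarith [ht.2])⟩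
  have hI' : ∀ t ∈ Ioo a b, (b - a)⁻¹ * t + -(a * (b - a)⁻¹) ∈ Ioo (0 : ℝ) 1 := fun t ht => by
    rw [hp]
    exact ⟨div_pos (by linarith [ht.1]) hba, (div_lt_one hba).2 (by linarith [ht.2])⟩
  obtain ⟨F, hF⟩ := id hγ
  have hs : SolvesOn (A.along f) a b (fun s => k ((b - a)⁻¹ * s + -(a * (b - a)⁻¹))) := by
    refine hk.comp_affine (inv_ne_zero hba.ne') hI hI' (F.image fun t => (b - a) * t + a)
      fun t ht htF => ?_
    refine A.along_comp_affine ?_ (IsPiecewiseAnalytic.mdifferentiableAt hF (hI' t ht)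
      fun hmem => htF (Finset.mem_image.2 ⟨_, hmem, ?_⟩))
    · filter_upwards [Icc_mem_nhds ht.1 ht.2] with s hs
      rw [h _ (hI s hs)]
      congr 1
      rw [hp]
      field_simp
      ring
    · rw [hp]
      field_simp
      ring
  refine ⟨⟨_, hs⟩, ?_⟩
  rw [holonomy_eq A hγ hk, transport_eq A hab.le hs]
  simp only [hp, sub_self, zero_div, div_self hba.ne']

theorem IsArc.exists_solvesOn {f : ℝ → M} {a b : ℝ} (hf : IsArc E f a b)
    (A : LieAlgebraForm E M V G) : ∃ g : ℝ → G, SolvesOn (A.along f) a b g := by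
  obtain ⟨γ, hγ, h⟩ := exists_path_of_analytic hf.lt hf.analytic
  exact (exists_solvesOn_of_path A hγ hf.lt h).1

theorem IsArc.mdifferentiableAt {f : ℝ → M} {a b t : ℝ} (hf : IsArc E f a b) (ht : t ∈ Ioo a b) :
    MDifferentiableAt 𝓘(ℝ, ℝ) 𝓘(ℝ, E) f t :=
  (hf.analytic.contMDiffAt (Icc_mem_nhds ht.1 ht.2)).mdifferentiableAt (by simp)

theorem IsArc.image_Icc [T2Space M] {f : ℝ → M} {a b : ℝ} (hf : IsArc E f a b) :
    f '' Icc a b = closure (f '' Ioo a b) := by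
  refine Subset.antisymm ?_ (closure_minimal (image_mono Ioo_subset_Icc_self)
    (isCompact_Icc.image_of_continuousOn hf.analytic.continuousOn).isClosed)
  rw [← closure_Ioo hf.lt.ne]
  exact ContinuousOn.image_closure (by
    rw [closure_Ioo hf.lt.ne]; exact hf.analytic.continuousOn)

/-- The change of parameter between two arcs with the same interior. It is differentiable in the
interior by the inverse function theorem, because the second arc is regular there. -/
theorem IsArc.exists_reparametrization [CompleteSpace E] [T2Space M] {f g : ℝ → M} {a b c d : ℝ}
    (hf : IsArc E f a b) (hg : IsArc E g c d) (h : f '' Ioo a b = g '' Ioo c d) :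
    ∃ φ : ℝ → ℝ, ContinuousOn φ (Icc a b) ∧ InjOn φ (Icc a b) ∧ MapsTo φ (Icc a b) (Icc c d) ∧
      MapsTo φ (Ioo a b) (Ioo c d) ∧ (∀ t ∈ Icc a b, g (φ t) = f t) ∧
      (∀ t ∈ Ioo a b, DifferentiableAt ℝ φ t) ∧
      (φ a = c ∧ φ b = d ∨ φ a = d ∧ φ b = c) := by
  have himg : f '' Icc a b = g '' Icc c d := by rw [hf.image_Icc, hg.image_Icc, h]
  have hex : ∀ t : ℝ, ∃ s, t ∈ Icc a b → s ∈ Icc c d ∧ g s = f t := fun t => by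
    by_cases ht : t ∈ Icc a b
    · obtain ⟨s, hs, e⟩ := himg.subset ⟨t, ht, rfl⟩
      exact ⟨s, fun _ => ⟨hs, e⟩⟩
    · exact ⟨0, fun h => absurd h ht⟩
  choose φ hφ using hex
  have hmaps : MapsTo φ (Icc a b) (Icc c d) := fun t ht => (hφ t ht).1
  have hgφ : ∀ t ∈ Icc a b, g (φ t) = f t := fun t ht => (hφ t ht).2
  have hinj : InjOn φ (Icc a b) := fun s hs t ht e => by
    refine hf.injOn hs ht ?_
    rw [← hgφ s hs, ← hgφ t ht, e]
  have hcont : ContinuousOn φ (Icc a b) := by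
    have hgc : Continuous ((Icc c d).domRestrict g) :=
      continuousOn_iff_continuous_domRestrict.1 hg.analytic.continuousOn
    have hemb : IsClosedEmbedding ((Icc c d).domRestrict g) :=
      hgc.isClosedEmbedding (injOn_iff_injective.1 hg.injOn)
    rw [continuousOn_iff_continuous_domRestrict]
    have : Continuous (hmaps.restrict φ _ _) := by
      rw [hemb.isInducing.continuous_iff]
      have he : (Icc c d).domRestrict g ∘ hmaps.restrict φ _ _ = (Icc a b).domRestrict f := by
        ext t
        exact hgφ t t.2
      rw [he]
      exact continuousOn_iff_continuous_domRestrict.1 hf.analytic.continuousOn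
    exact continuous_subtype_val.comp this
  have hsurj : SurjOn φ (Icc a b) (Icc c d) := fun s hs => by
    obtain ⟨t, ht, e⟩ := himg.superset ⟨s, hs, rfl⟩
    exact ⟨t, ht, hg.injOn (hmaps ht) hs (by rw [hgφ t ht, e])⟩
  have hmaps' : MapsTo φ (Ioo a b) (Ioo c d) := fun t ht => by
    obtain ⟨s, hs, e⟩ := h.subset ⟨t, ht, rfl⟩
    rwa [hg.injOn (hmaps (Ioo_subset_Icc_self ht)) (Ioo_subset_Icc_self hs)
      (by rw [hgφ t (Ioo_subset_Icc_self ht), e])]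
  refine ⟨φ, hcont, hinj, hmaps, hmaps', hgφ, fun t ht => ?_, ?_⟩
  · obtain ⟨u, u', hu, hd, hne⟩ := hg.regular _ (hmaps' ht)
    have htI := Ioo_subset_Icc_self ht
    have hgφt : MDifferentiableAt 𝓘(ℝ, ℝ) 𝓘(ℝ, ℝ) (fun s => u (f s)) t := by
      refine MDifferentiableAt.comp (g := u) t ?_ (hf.mdifferentiableAt ht)
      rw [← hgφ t htI]
      exact hu.mdifferentiableAt (by simp)
    have hga : ContDiffAt ℝ ω (fun s => u (g s)) (φ t) := by
      rw [← contMDiffAt_iff_contDiffAt]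
      exact ContMDiffAt.comp (g := u) _ hu
        (hg.analytic.contMDiffAt (Icc_mem_nhds (hmaps' ht).1 (hmaps' ht).2))
    have hst : HasStrictDerivAt (fun s => u (g s)) u' (φ t) := by
      have := hga.hasStrictDerivAt (by simp)
      rwa [hd.deriv] at this
    have hφt : ContinuousAt φ t := hcont.continuousAt (Icc_mem_nhds ht.1 ht.2)
    have hinv := (hst.to_localInverse hne).hasDerivAt.differentiableAt
    have hcomp : DifferentiableAt ℝ
        (fun s => hst.localInverse _ _ _ hne (u (f s))) t := by
      refine DifferentiableAt.comp (g := hst.localInverse _ _ _ hne) t ?_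
        hgφt.differentiableAt
      rwa [← hgφ t htI]
    refine hcomp.congr_of_eventuallyEq ?_
    filter_upwards [hφt.eventually (hst.eventually_left_inverse hne), Icc_mem_nhds ht.1 ht.2]
      with s h1 h2
    rw [← hgφ s h2, h1]
  · have hle := hf.lt.le
    have hcd := hg.lt.le
    obtain ⟨s, hs, hsc⟩ := hsurj ⟨le_rfl, hcd⟩
    obtain ⟨r, hr, hrd⟩ := hsurj ⟨hcd, le_rfl⟩
    have hs' : s = a ∨ s = b := by
      rcases eq_endpoints_or_mem_Ioo_of_mem_Icc hs with h | h | h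
      exacts [.inl h, .inr h, absurd (hmaps' h).1 (by simp [hsc])]
    have hr' : r = a ∨ r = b := by
      rcases eq_endpoints_or_mem_Ioo_of_mem_Icc hr with h | h | h
      exacts [.inl h, .inr h, absurd (hmaps' h).2 (by simp [hrd])]
    have hlt := hg.lt
    rcases hs' with rfl | rfl <;> rcases hr' with rfl | rfl
    · linarith
    · exact .inl ⟨hsc, hrd⟩
    · exact .inr ⟨hrd, hsc⟩
    · linarith

/-- Transport along an arc depends only on its interior, up to a reversal of direction. -/
theorem IsArc.transport_eq_or [CompleteSpace E] [T2Space M] {f g : ℝ → M} {a b c d : ℝ}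
    (hf : IsArc E f a b) (hg : IsArc E g c d) (h : f '' Ioo a b = g '' Ioo c d) :
    (f a = g c ∧ f b = g d ∧
      ∀ A : LieAlgebraForm E M V G, transport A f a b = transport A g c d) ∨
    (f a = g d ∧ f b = g c ∧
      ∀ A : LieAlgebraForm E M V G, transport A f a b = (transport A g c d)⁻¹) := by
  obtain ⟨φ, hφ, hφi, hm, hm', hgφ, hd, hends⟩ := hf.exists_reparametrization hg h
  have key : ∀ (A : LieAlgebraForm E M V G) (k : ℝ → G), SolvesOn (A.along g) c d k →
      transport A f a b = k (φ b) * (k (φ a))⁻¹ := by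
    intro A k hk
    refine transport_eq A hf.lt.le (g := fun s => k (φ s)) (hk.comp hφ hφi hm hm' fun t ht => ?_)
    refine ⟨_, (hd t ht).hasDerivAt, A.along_comp ?_ (hd t ht).hasDerivAt
      (hg.mdifferentiableAt (hm' ht))⟩
    filter_upwards [Icc_mem_nhds ht.1 ht.2] with s hs using (hgφ s hs).symm
  have ea := hgφ a ⟨le_rfl, hf.lt.le⟩
  have eb := hgφ b ⟨hf.lt.le, le_rfl⟩
  rcases hends with ⟨h1, h2⟩ | ⟨h1, h2⟩
  · refine .inl ⟨by rw [← ea, h1], by rw [← eb, h2], fun A => ?_⟩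
    obtain ⟨k, hk⟩ := hg.exists_solvesOn A
    rw [key A k hk, transport_eq A hg.lt.le hk, h1, h2]
  · refine .inr ⟨by rw [← ea, h1], by rw [← eb, h2], fun A => ?_⟩
    obtain ⟨k, hk⟩ := hg.exists_solvesOn A
    rw [key A k hk, transport_eq A hg.lt.le hk, h1, h2]
    group

end Transport

/-! ### Generators of the loops in a graph -/

section Graph

variable {E : Type*} [NormedAddCommGroup E] [NormedSpace ℝ E]
  {M : Type*} [TopologicalSpace M] [ChartedSpace E M] [IsManifold 𝓘(ℝ, E) ω M]
  {V : Type*} [NormedAddCommGroup V] [NormedSpace ℝ V] [FiniteDimensional ℝ V]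
  {G : Type*} [TopologicalSpace G] [T2Space G] [ChartedSpace V G] [Group G] [LieGroup 𝓘(ℝ, V) ∞ G]
  {x₀ : M}

/-- The holonomy of a fixed form, as a homomorphism on the hoop group. -/
def holonomyHom (A : LieAlgebraForm E M V G) : HoopGroup E V G x₀ →* G :=
  MonoidHom.mk' (Quotient.lift (fun α : Loop E x₀ => holonomy A α.1 α.2) fun _ _ h => h A) (by
    rintro ⟨α⟩ ⟨β⟩
    exact holonomy_trans A β.2 α.2)

theorem holonomyHom_hoop (A : LieAlgebraForm E M V G) (α : Loop E x₀) :
    holonomyHom A (α.hoop V G) = holonomy A α.1 α.2 := rfl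

theorem hoop_ext {g h : HoopGroup E V G x₀}
    (H : ∀ A : LieAlgebraForm E M V G, holonomyHom A g = holonomyHom A h) : g = h := by
  induction g using Quotient.inductionOn
  induction h using Quotient.inductionOn
  exact Quotient.sound H

/-- The union of the arcs of a family, together with the base point. -/
def supportOf (x₀ : M) (D : ArcFamily M) : Set M :=
  insert x₀ (⋃ e ∈ D, e.1 '' Icc e.2.1 e.2.2)

theorem supportOf_mono {D D' : ArcFamily M} (h : D ⊆ D') : supportOf x₀ D ⊆ supportOf x₀ D' :=
  insert_subset_insert (biUnion_subset_biUnion_left h)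

/-- The arcs `D` form a tree with vertex set `R` as far as holonomies can tell: every vertex `v` is
joined to the base point by a path in `D` with holonomies `Q v`, and running along an arc of `D`
after the path to its initial point amounts to taking the path to its final point. -/
structure IsSpanningTree (x₀ : M) (D : ArcFamily M) (R : Set M)
    (Q : M → LieAlgebraForm E M V G → G) : Prop where
  base_mem : x₀ ∈ R
  base : Q x₀ = 1
  path : ∀ v ∈ R, ∃ (γ : Path x₀ v) (hγ : IsPiecewiseAnalytic E γ),
    range γ ⊆ supportOf x₀ D ∧ ∀ A, holonomy A γ hγ = Q v A
  arc : ∀ e ∈ D, e.1 e.2.1 ∈ R ∧ e.1 e.2.2 ∈ R ∧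
    ∀ A, transport A e.1 e.2.1 e.2.2 * Q (e.1 e.2.1) A = Q (e.1 e.2.2) A

theorem isSpanningTree_empty (x₀ : M) :
    IsSpanningTree x₀ ∅ {x₀} (1 : M → LieAlgebraForm E M V G → G) where
  base_mem := rfl
  base := rfl
  path := by
    rintro v rfl
    refine ⟨Path.refl v, .refl v, ?_, fun A => holonomy_refl A v⟩
    rintro _ ⟨t, rfl⟩
    exact mem_insert _ _
  arc := by simp

open Classical in
/-- A tree is enlarged by an arc, run through by `δ` in one of its directions, that leads to a new
vertex. -/
theorem IsSpanningTree.extend {D : ArcFamily M} {R : Set M}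
    {Q : M → LieAlgebraForm E M V G → G} (h : IsSpanningTree x₀ D R Q)
    (e : (ℝ → M) × ℝ × ℝ) {v w : M} (δ : Path v w) (hδ : IsPiecewiseAnalytic E δ)
    (hr : range δ ⊆ e.1 '' Icc e.2.1 e.2.2) (hv : v ∈ R) (hw : w ∉ R)
    (he : e.1 e.2.1 = v ∧ e.1 e.2.2 = w ∧
        (∀ A : LieAlgebraForm E M V G, holonomy A δ hδ = transport A e.1 e.2.1 e.2.2) ∨
      e.1 e.2.1 = w ∧ e.1 e.2.2 = v ∧
        ∀ A : LieAlgebraForm E M V G, holonomy A δ hδ = (transport A e.1 e.2.1 e.2.2)⁻¹) :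
    IsSpanningTree x₀ (insert e D) (insert w R)
      (Function.update Q w fun A => holonomy A δ hδ * Q v A) := by
  have hne : ∀ {u}, u ∈ R → u ≠ w := fun hu he => hw (he ▸ hu)
  refine ⟨mem_insert_of_mem _ h.base_mem, ?_, ?_, ?_⟩
  · rw [Function.update_of_ne (hne h.base_mem), h.base]
  · rintro u (rfl | hu)
    · obtain ⟨γ, hγ, h1, h2⟩ := h.path v hv
      refine ⟨γ.trans δ, hγ.trans hδ, ?_, fun A => ?_⟩
      · rw [Path.trans_range]
        refine union_subset (h1.trans (supportOf_mono (subset_insert _ _))) ?_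
        exact hr.trans (fun x hx => .inr (mem_biUnion (mem_insert e D) hx))
      · rw [holonomy_trans A hγ hδ, h2, Function.update_self]
    · obtain ⟨γ, hγ, h1, h2⟩ := h.path u hu
      refine ⟨γ, hγ, h1.trans (supportOf_mono (subset_insert _ _)), fun A => ?_⟩
      rw [h2, Function.update_of_ne (hne hu)]
  · rintro k (rfl | hk)
    · rcases he with ⟨h1, h2, h3⟩ | ⟨h1, h2, h3⟩
      · refine ⟨.inr (h1 ▸ hv), .inl h2, fun A => ?_⟩
        rw [h1, h2, Function.update_self, Function.update_of_ne (hne hv), h3]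
      · refine ⟨.inl h1, .inr (h2 ▸ hv), fun A => ?_⟩
        rw [h1, h2, Function.update_self, Function.update_of_ne (hne hv), h3,
          mul_inv_cancel_left]
    · obtain ⟨h1, h2, h3⟩ := h.arc k hk
      refine ⟨.inr h1, .inr h2, fun A => ?_⟩
      rw [Function.update_of_ne (hne h1), Function.update_of_ne (hne h2), h3]

theorem IsArc.exists_path {f : ℝ → M} {a b : ℝ} (hf : IsArc E f a b) :
    ∃ (γ : Path (f a) (f b)) (hγ : IsPiecewiseAnalytic E γ),
      (∀ t ∈ Icc (0 : ℝ) 1, γ.extend t = f ((b - a) * t + a)) ∧ range γ ⊆ f '' Icc a b ∧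
      ∀ A : LieAlgebraForm E M V G, holonomy A γ hγ = transport A f a b := by
  obtain ⟨γ, hγ, h⟩ := exists_path_of_analytic hf.lt hf.analytic
  refine ⟨γ, hγ, h, ?_, fun A => (exists_solvesOn_of_path A hγ hf.lt h).2⟩
  rintro _ ⟨t, rfl⟩
  have := h t t.2
  rw [Path.extend_apply _ t.2] at this
  exact ⟨_, ⟨by nlinarith [hf.lt, t.2.1], by nlinarith [hf.lt, t.2.2]⟩, this.symm⟩

/-- The loop that runs along `p`, then along an arc, then back along `q`. If the arc meets `p` and
`q` at most in its end points, then the loop traverses its interior only once. -/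
theorem IsArc.exists_loop {f : ℝ → M} {a b : ℝ} (hf : IsArc E f a b) {p : Path x₀ (f a)}
    (hp : IsPiecewiseAnalytic E p) {q : Path x₀ (f b)} (hq : IsPiecewiseAnalytic E q)
    (hdp : Disjoint (f '' Ioo a b) (range p)) (hdq : Disjoint (f '' Ioo a b) (range q)) :
    ∃ α : Loop E x₀, range α.1 ⊆ f '' Icc a b ∪ range p ∪ range q ∧
      (∀ A : LieAlgebraForm E M V G,
        holonomy A α.1 α.2 = (holonomy A q hq)⁻¹ * (transport A f a b * holonomy A p hp)) ∧
      ∃ c d : ℝ, 0 ≤ c ∧ c < d ∧ d ≤ 1 ∧ α.1.extend '' Ioo c d ⊆ f '' Ioo a b ∧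
        ∀ t ∈ Ioo c d, ∀ s ∈ Icc (0 : ℝ) 1, α.1.extend s = α.1.extend t → s = t := by
  obtain ⟨γ, hγ, hγf, hγr, hγA⟩ := hf.exists_path (V := V) (G := G)
  have hlt := hf.lt
  have hmid : ∀ t ∈ Icc (1 / 4 : ℝ) (1 / 2),
      ((p.trans γ).trans q.symm).extend t = f ((b - a) * (4 * t - 1) + a) := by
    intro t ht
    rw [Path.extend_trans_of_le_half _ _ ht.2,
      Path.extend_trans_of_half_le _ _ (by linarith [ht.1]),
      hγf _ ⟨by linarith [ht.1], by linarith [ht.2]⟩]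
    congr 2
    ring
  have hin : ∀ t ∈ Ioo (1 / 4 : ℝ) (1 / 2), (b - a) * (4 * t - 1) + a ∈ Ioo a b := fun t ht =>
    ⟨by nlinarith [ht.1], by nlinarith [ht.2]⟩
  refine ⟨⟨(p.trans γ).trans q.symm, (hp.trans hγ).trans hq.symm⟩, ?_, fun A => ?_,
    1 / 4, 1 / 2, by norm_num, by norm_num, by norm_num, ?_, ?_⟩
  · dsimp only
    rw [Path.trans_range, Path.trans_range, Path.symm_range]
    rintro x ((hx | hx) | hx)
    exacts [.inl (.inr hx), .inl (.inl (hγr hx)), .inr hx]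
  · dsimp only
    rw [holonomy_trans A (hp.trans hγ) hq.symm, holonomy_trans A hp hγ, holonomy_symm A hq, hγA]
  · rintro _ ⟨t, ht, rfl⟩
    exact ⟨_, hin t ht, (hmid t (Ioo_subset_Icc_self ht)).symm⟩
  · intro t ht s hs hst
    dsimp only at hst
    have ht' : ((p.trans γ).trans q.symm).extend t ∈ f '' Ioo a b :=
      ⟨_, hin t ht, (hmid t (Ioo_subset_Icc_self ht)).symm⟩
    rcases lt_or_ge s (1 / 4) with h1 | h1
    · rw [← hst, Path.extend_trans_of_le_half _ _ (by linarith),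
        Path.extend_trans_of_le_half _ _ (by linarith)] at ht'
      exact absurd (by rw [← Path.extend_range]; exact mem_range_self _)
        (disjoint_left.1 hdp ht')
    rcases lt_or_ge (1 / 2) s with h2 | h2
    · rw [← hst, Path.extend_trans_of_half_le _ _ h2.le] at ht'
      exact absurd (by rw [← Path.symm_range, ← Path.extend_range]; exact mem_range_self _)
        (disjoint_left.1 hdq ht')
    rw [hmid s ⟨h1, h2⟩, hmid t (Ioo_subset_Icc_self ht)] at hst
    have := hf.injOn ⟨by nlinarith, by nlinarith⟩ (Ioo_subset_Icc_self (hin t ht)) hst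
    have := mul_left_cancel₀ (sub_pos.2 hlt).ne' (add_right_cancel this)
    linarith

/-- In a finite graph, the loops formed by the arcs outside a maximal tree are independent, and up
to tree paths every arc that can be reached from the base point is a product of them. -/
theorem exists_independent_generators {K : ArcFamily M} (hK : K.Finite)
    (harc : ∀ e ∈ K, IsArc E e.1 e.2.1 e.2.2) (hx₀ : ∀ e ∈ K, x₀ ∉ interiorOf e)
    (hdisj : ∀ e ∈ K, ∀ e' ∈ K, e ≠ e' → Disjoint (interiorOf e) (e'.1 '' Icc e'.2.1 e'.2.2)) :
    ∃ (n : ℕ) (β : Fin n → Loop E x₀) (R : Set M) (Q : M → LieAlgebraForm E M V G → G),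
      IndependentLoops β ∧ x₀ ∈ R ∧ Q x₀ = 1 ∧ ∀ e ∈ K, (e.1 e.2.1 ∈ R ↔ e.1 e.2.2 ∈ R) ∧
        (e.1 e.2.1 ∈ R → ∃ h ∈ Subgroup.closure (range fun i => (β i).hoop V G), ∀ A,
          transport A e.1 e.2.1 e.2.2 * Q (e.1 e.2.1) A =
            Q (e.1 e.2.2) A * holonomyHom A h) := by
  have hfin : {D | D ⊆ K ∧ ∃ R, ∃ Q : M → LieAlgebraForm E M V G → G,
      IsSpanningTree x₀ D R Q}.Finite := hK.finite_subsets.subset fun D h => h.1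
  obtain ⟨D, ⟨hDK, R, Q, hD⟩, hmax⟩ :=
    hfin.exists_maximal ⟨∅, empty_subset K, _, _, isSpanningTree_empty x₀⟩
  have hext : ∀ e ∈ K, ∀ R' Q', IsSpanningTree (V := V) (G := G) x₀ (insert e D) R' Q' → e ∈ D :=
    fun e he R' Q' h => hmax ⟨insert_subset he hDK, R', Q', h⟩ (subset_insert e D) (mem_insert e D)
  have hR : ∀ e ∈ K, (e.1 e.2.1 ∈ R ↔ e.1 e.2.2 ∈ R) := by
    intro e he
    obtain ⟨γ, hγ, -, hγr, hγA⟩ := (harc e he).exists_path (V := V) (G := G)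
    by_cases heD : e ∈ D
    · obtain ⟨h1, h2, -⟩ := hD.arc e heD
      exact iff_of_true h1 h2
    · constructor <;> intro h <;> by_contra h'
      · exact heD (hext e he _ _ (hD.extend e γ hγ hγr h h' (.inl ⟨rfl, rfl, hγA⟩)))
      · exact heD (hext e he _ _ (hD.extend e γ.symm hγ.symm (by rwa [Path.symm_range]) h h'
          (.inr ⟨rfl, rfl, fun A => by rw [holonomy_symm A hγ, hγA]⟩)))
  have hsupp : ∀ e ∈ K, e ∉ D → Disjoint (interiorOf e) (supportOf x₀ D) := by
    intro e he heD
    refine disjoint_left.2 fun x hx hx' => ?_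
    rcases hx' with rfl | hx'
    · exact hx₀ e he hx
    · obtain ⟨k, hk, hxk⟩ := mem_iUnion₂.1 hx'
      exact disjoint_left.1 (hdisj e he k (hDK hk) fun h => heD (h ▸ hk)) hx hxk
  let N : ArcFamily M := {e ∈ K | e ∉ D ∧ e.1 e.2.1 ∈ R}
  have hN : ∀ e : N, ∃ α : Loop E x₀,
      range α.1 ⊆ e.1.1 '' Icc e.1.2.1 e.1.2.2 ∪ supportOf x₀ D ∧
      (∀ A : LieAlgebraForm E M V G, holonomy A α.1 α.2 = (Q (e.1.1 e.1.2.2) A)⁻¹ *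
        (transport A e.1.1 e.1.2.1 e.1.2.2 * Q (e.1.1 e.1.2.1) A)) ∧
      ∃ c d : ℝ, 0 ≤ c ∧ c < d ∧ d ≤ 1 ∧ α.1.extend '' Ioo c d ⊆ interiorOf e.1 ∧
        ∀ t ∈ Ioo c d, ∀ s ∈ Icc (0 : ℝ) 1, α.1.extend s = α.1.extend t → s = t := by
    rintro ⟨e, he, heD, heR⟩
    obtain ⟨p, hp, hpr, hpA⟩ := hD.path _ heR
    obtain ⟨q, hq, hqr, hqA⟩ := hD.path _ ((hR e he).1 heR)
    obtain ⟨α, h1, h2, h3⟩ := (harc e he).exists_loop (V := V) (G := G) hp hq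
      ((hsupp e he heD).mono_right hpr) ((hsupp e he heD).mono_right hqr)
    refine ⟨α, h1.trans ?_, fun A => by rw [h2, hpA, hqA], h3⟩
    exact union_subset (union_subset subset_union_left (hpr.trans subset_union_right))
      (hqr.trans subset_union_right)
  choose β hβr hβA hβ using hN
  have : Finite N := (hK.subset (sep_subset _ _)).to_subtype
  let ι := Finite.equivFin N
  refine ⟨Nat.card N, fun i => β (ι.symm i), R, Q, fun i => ?_, hD.base_mem, hD.base,
    fun e he => ⟨hR e he, fun heR => ?_⟩⟩
  · obtain ⟨c, d, h0, h1, h2, h3, h4⟩ := hβ (ι.symm i)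
    refine ⟨c, d, h0, h1, h2, h4, fun j hj => ?_⟩
    convert Set.finite_empty
    rw [← disjoint_iff_inter_eq_empty]
    obtain ⟨hiK, hiD, -⟩ := (ι.symm i).2
    refine Disjoint.mono h3 (hβr (ι.symm j)) (disjoint_union_right.2 ⟨?_, hsupp _ hiK hiD⟩)
    exact hdisj _ hiK _ (ι.symm j).2.1 fun h => hj (ι.symm.injective (Subtype.ext h)).symm
  · by_cases heD : e ∈ D
    · exact ⟨1, one_mem _, fun A => by rw [(hD.arc e heD).2.2 A, map_one, mul_one]⟩
    · let k : N := ⟨e, he, heD, heR⟩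
      refine ⟨(β k).hoop V G, Subgroup.subset_closure ⟨ι k, by simp only [ι.symm_apply_apply]⟩, fun A => ?_⟩
      rw [holonomyHom_hoop, hβA k A, mul_inv_cancel_left]

end Graph

/-! ### Finite sets of hoops lie in tame subgroups -/

section Tame

variable {E : Type*} [NormedAddCommGroup E] [NormedSpace ℝ E] [FiniteDimensional ℝ E]
  {M : Type*} [TopologicalSpace M] [T2Space M] [ChartedSpace E M] [IsManifold 𝓘(ℝ, E) ω M]
  {V : Type*} [NormedAddCommGroup V] [NormedSpace ℝ V] [FiniteDimensional ℝ V]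
  {G : Type*} [TopologicalSpace G] [T2Space G] [ChartedSpace V G] [Group G] [LieGroup 𝓘(ℝ, V) ∞ G]
  {x₀ : M}

/-- The hoops of finitely many loops lie in a common tame subgroup: the loops run in a finite graph
made of arcs, whose loops are generated by independent ones. -/
theorem exists_isTame_of_loops {s : Set (Loop E x₀)} (hs : s.Finite) :
    ∃ S : Subgroup (HoopGroup E V G x₀), IsTame S ∧ ∀ α ∈ s, α.hoop V G ∈ S := by
  have := FiniteDimensional.complete ℝ E
  choose F hF0 hF1 hFI hF using fun α : Loop E x₀ => α.2.exists_pieces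
  let T : ArcFamily M := {e | ∃ α ∈ s, e.1 = ⇑α.1.extend ∧ e.2.1 ∈ F α ∧ e.2.2 ∈ F α ∧
    IsArc E e.1 e.2.1 e.2.2}
  have hT : T.Finite := by
    have : (⋃ α ∈ s, ({⇑α.1.extend} : Set (ℝ → M)) ×ˢ ((F α : Set ℝ) ×ˢ (F α : Set ℝ))).Finite :=
      hs.biUnion fun α _ => (finite_singleton _).prod
        ((F α).finite_toSet.prod (F α).finite_toSet)
    refine this.subset ?_
    rintro e ⟨α, hα, h1, h2, h3, -⟩
    exact mem_iUnion₂.2 ⟨α, hα, h1, h2, h3⟩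
  obtain ⟨K', hK', harc', hx₀', hdisj', hsub⟩ :=
    exists_graph (E := E) hT (fun e ⟨_, _, _, _, _, h⟩ => h) x₀
  -- one arc is kept out of those with the same interior
  obtain ⟨K, hKK', hbij⟩ := exists_subset_bijOn K' interiorOf
  obtain ⟨n, β, R, Q, hβ, hR0, hQ0, hKR⟩ := exists_independent_generators (V := V) (G := G)
    (hK'.subset hKK') (fun e he => harc' e (hKK' he)) (fun e he => hx₀' e (hKK' he))
    (fun e he e' he' hne => (hdisj' e (hKK' he) e' (hKK' he')).resolve_left
      fun h => hne (hbij.injOn he he' h))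
  let S := Subgroup.closure (range fun i => (β i).hoop V G)
  refine ⟨S, ⟨n, _, ⟨β, fun _ => rfl, hβ⟩, rfl⟩, fun α hα => ?_⟩
  -- running along `α` from time `c` to time `d` is an element of `S` up to tree paths
  let Step : ℝ → ℝ → Prop := fun c d => 0 ≤ c ∧ c < d ∧ d ≤ 1 ∧ (α.1.extend c ∈ R →
    α.1.extend d ∈ R ∧ ∃ h ∈ S, ∀ A : LieAlgebraForm E M V G,
      transport A α.1.extend c d * Q (α.1.extend c) A = Q (α.1.extend d) A * holonomyHom A h)
  have htrans : ∀ {x y z : ℝ}, Step x y → Step y z → Step x z := by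
    rintro x y z ⟨hx, hxy, -, h1⟩ ⟨-, hyz, hz, h2⟩
    refine ⟨hx, hxy.trans hyz, hz, fun hR => ?_⟩
    obtain ⟨hR', h, hh, hA⟩ := h1 hR
    obtain ⟨hR'', k, hk, hA'⟩ := h2 hR'
    refine ⟨hR'', k * h, mul_mem hk hh, fun A => ?_⟩
    rw [transport_trans A α.2 hx hxy.le hyz.le hz, mul_assoc, hA, ← mul_assoc, hA', map_mul,
      mul_assoc]
  have hedge : ∀ c d : ℝ, 0 ≤ c → c < d → d ≤ 1 → (⇑α.1.extend, c, d) ∈ K' → Step c d := by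
    intro c d hc hcd hd hmem
    refine ⟨hc, hcd, hd, fun hR => ?_⟩
    obtain ⟨e, he, hint⟩ := hbij.surjOn ⟨_, hmem, rfl⟩
    obtain ⟨hiff, hgen⟩ := hKR e he
    rcases (harc' _ hmem).transport_eq_or (V := V) (G := G) (harc' e (hKK' he)) hint.symm with
      ⟨h1, h2, h3⟩ | ⟨h1, h2, h3⟩ <;> dsimp only at h1 h2 h3 <;> rw [h1] at hR <;>
      simp only [h1, h2, h3]
    · exact ⟨hiff.1 hR, hgen hR⟩
    · obtain ⟨h, hh, hA⟩ := hgen (hiff.2 hR)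
      refine ⟨hiff.2 hR, h⁻¹, inv_mem hh, fun A => ?_⟩
      rw [inv_mul_eq_iff_eq_mul, ← mul_assoc, hA, map_inv, mul_inv_cancel_right]
  have hstep : Step 0 1 := by
    refine rel_of_consecutive (Q := Step) htrans (F α) (fun c hc d hd hcd hcons => ?_) (hF0 α) (hF1 α)
      zero_lt_one
    have hc0 := (hFI α c hc).1
    have hd1 := (hFI α d hd).2
    obtain ⟨han, hconst | ⟨hinj, hreg⟩⟩ := hF α c d hc0 hcd hd1 hcons
    · refine ⟨hc0, hcd, hd1, fun hR => ?_⟩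
      have hdc := hconst d ⟨hcd.le, le_rfl⟩
      refine ⟨hdc ▸ hR, 1, one_mem _, fun A => ?_⟩
      rw [transport_const A hcd.le hconst, hdc, map_one, one_mul, mul_one]
    · obtain ⟨F', hcF, hdF, hFI', hF'⟩ := hsub (⇑α.1.extend, c, d)
        ⟨α, hα, rfl, hc, hd, hcd, han, hinj, hreg⟩
      exact rel_of_consecutive (Q := Step) htrans F' (fun x hx y hy hxy h =>
        hedge x y (hc0.trans (hFI' x hx).1) hxy ((hFI' y hy).2.trans hd1)
          (hF' x hx y hy hxy h)) hcF hdF hcd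
  obtain ⟨-, h, hh, hA⟩ := hstep.2.2.2 (by simpa using hR0)
  have : α.hoop V G = h := hoop_ext fun A => by
    have := hA A
    rw [Path.extend_zero, Path.extend_one, hQ0] at this
    rw [holonomyHom_hoop, holonomy_eq_transport]
    simpa using this
  rwa [this]

theorem exists_isTame_of_finite {s : Set (HoopGroup E V G x₀)} (hs : s.Finite) :
    ∃ S : Subgroup (HoopGroup E V G x₀), IsTame S ∧ s ⊆ S := by
  obtain ⟨S, hS, h⟩ := exists_isTame_of_loops (V := V) (G := G) (hs.image Quotient.out)
  refine ⟨S, hS, fun g hg => ?_⟩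
  have e : Loop.hoop V G (Quotient.out g : Loop E x₀) = g := Quotient.out_eq g
  exact e ▸ h _ (mem_image_of_mem _ hg)

theorem exists_mem_tameSubgroup (g : HoopGroup E V G x₀) :
    ∃ S : TameSubgroup E V G x₀, g ∈ S.1 := by
  obtain ⟨S, hS, h⟩ := exists_isTame_of_finite (finite_singleton g)
  exact ⟨⟨S, hS⟩, h rfl⟩

/-- The tame subgroups form a directed set. -/
theorem exists_tameSubgroup_ge (S S' : TameSubgroup E V G x₀) :
    ∃ S'' : TameSubgroup E V G x₀, S ≤ S'' ∧ S' ≤ S'' := by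
  obtain ⟨S, n, β, hβ, rfl⟩ := S
  obtain ⟨S', n', β', hβ', rfl⟩ := S'
  obtain ⟨T, hT, h⟩ := exists_isTame_of_finite ((finite_range β).union (finite_range β'))
  exact ⟨⟨T, hT⟩, (Subgroup.closure_le T).2 (subset_union_left.trans h),
    (Subgroup.closure_le T).2 (subset_union_right.trans h)⟩

/-- The values of a consistent family at a hoop do not depend on the tame subgroup. -/
theorem hoopProjectiveLimit_apply_eq {x : ∀ S : TameSubgroup E V G x₀, S.1 →* G}
    (hx : x ∈ hoopProjectiveLimit E V G x₀) {S S' : TameSubgroup E V G x₀}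
    {g : HoopGroup E V G x₀} (hg : g ∈ S.1) (hg' : g ∈ S'.1) : x S ⟨g, hg⟩ = x S' ⟨g, hg'⟩ := by
  obtain ⟨T, hST, hS'T⟩ := exists_tameSubgroup_ge S S'
  rw [← hx hST, ← hx hS'T]
  rfl

end Tame

end

end Hoop

theorem proposition3
    {E : Type*} [NormedAddCommGroup E] [NormedSpace ℝ E] [FiniteDimensional ℝ E]
    {M : Type*} [TopologicalSpace M] [T2Space M] [ChartedSpace E M] [IsManifold 𝓘(ℝ, E) ω M]
    {V : Type*} [NormedAddCommGroup V] [NormedSpace ℝ V] [FiniteDimensional ℝ V]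
    {G : Type*} [TopologicalSpace G] [T2Space G] [CompactSpace G] [ConnectedSpace G]
    [ChartedSpace V G] [Group G] [LieGroup 𝓘(ℝ, V) ∞ G]
    (hG : ∃ a b : G, a * b ≠ b * a) (x₀ : M) :
    Function.Bijective (Hoop.restrictionMap E V G x₀) := by
  refine ⟨fun H H' h => ?_, fun ⟨x, hx⟩ => ?_⟩
  · ext g
    obtain ⟨S, hg⟩ := Hoop.exists_mem_tameSubgroup g
    have hS : (Hoop.restrictionMap E V G x₀ H).1 S = (Hoop.restrictionMap E V G x₀ H').1 S := by
      rw [h]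
    exact DFunLike.congr_fun hS ⟨g, hg⟩
  · choose S hS using Hoop.exists_mem_tameSubgroup (E := E) (V := V) (G := G) (x₀ := x₀)
    refine ⟨MonoidHom.mk' (fun g => x (S g) ⟨g, hS g⟩) fun g g' => ?_, Subtype.ext ?_⟩
    · -- a tame subgroup that contains both factors also contains the product
      obtain ⟨T, h, h'⟩ := Hoop.exists_tameSubgroup_ge (S g) (S g')
      rw [Hoop.hoopProjectiveLimit_apply_eq hx (hS g) (h (hS g)),
        Hoop.hoopProjectiveLimit_apply_eq hx (hS g') (h' (hS g')),
        Hoop.hoopProjectiveLimit_apply_eq hx (hS (g * g')) (mul_mem (h (hS g)) (h' (hS g'))),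
        ← map_mul]
      rfl
    · funext T
      ext g
      exact Hoop.hoopProjectiveLimit_apply_eq hx (hS g) g.2
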